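/- Let $\omega_{\mathrm{can}}=\mathrm dx_1\wedge \mathrm dy_1+\mathrm dx_2\wedge \mathrm dy_2$ on $\mathbb R^4$ and let $q=(q_1,q_2):\mathbb R^4\to\mathbb R^2$ be the focus-focus model $$q_1=x_1y_2-x_2y_1,\qquad q_2=x_1y_1+x_2y_2 .$$ Let $\mathrm{Aut}=\mathrm{Aut}((\mathbb R^4,0),\omega_{\mathrm{can}},q)$ be the group of germs at $0$ of ($C^\infty$) symplectomorphisms $\varphi$ of $(\mathbb R^4,0)$ for which there is a germ of local ($C^\infty$) diffeomorphism $g$ of $(\mathbb R^2,0)$ with $q\circ\varphi=g\circ q$. Let $G$ be the group of germs of local diffeomorphisms of $(\mathbb R^2,0)$ of the form $g(a,b)=(\epsilon_1 a,\ \epsilon_2 b+h(a,b))$, where $\epsilon_1,\epsilon_2\in\{\pm1\}$ and $h$ is a flat function, i.e. smooth near $(0,0)$ with zero Taylor series at $(0,0)$. **Proposition.** (i) A germ $g$ of local diffeomorphism of $(\mathbb R^2,0)$ satisfies $q\circ\varphi=g\circ q$ for some germ $\varphi$ of symplectomorphism of $(\mathbb R^4,0)$ if and only if $g\in G$. (ii)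 For every $\varphi\in\mathrm{Aut}$ the germ $g$ with $q\circ\varphi=g\circ q$ is unique, and $\varphi\mapsto g$ is a surjective group homomorphism $\mathrm{Aut}\to G$. (iii) The sign changes $g_\epsilon(a,b)=(\epsilon_1a,\epsilon_2b)$, $\epsilon=(\epsilon_1,\epsilon_2)\in\{\pm1\}^2$, which form a Klein four-group in $G$, are the images of explicit linear symplectomorphisms. Let $$A_{(-1,1)}(x_1,y_1,x_2,y_2)=(x_2,y_2,x_1,y_1),\qquad A_{(1,-1)}(x_1,y_1,x_2,y_2)=(y_1,-x_1,y_2,-x_2),$$ $A_{(1,1)}=\mathrm{id}$ and $A_{(-1,-1)}=A_{(-1,1)}\circ A_{(1,-1)}$. Then each $A_\epsilon$ is a linear symplectomorphism of $(\mathbb R^4,\omega_{\mathrm{can}})$ with $q\circ A_\epsilon=g_\epsilon\circ q$ on $\mathbb R^4$, so its germ lies in $\mathrm{Aut}$ and is mapped to $g_\epsilon$. The $A_\epsilon$ commute with each other, and $\epsilon\mapsto \pm A_\epsilon$ is an injective homomorphism $\{\pm1\}^2\to \mathrm{Sp}(4,\mathbb R)/\{\pm \mathrm{id}\}$. -/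

import Mathlib

open Filter Topology
open scoped ContDiff

namespace FocusFocus

/-! ### Germs of smooth maps `(E, 0) → (E, 0)` and of local diffeomorphisms -/

section Germs

variable (E : Type*) [NormedAddCommGroup E] [NormedSpace ℝ E]

/-- A map `E → E` that fixes the origin and is `C^∞` on some neighbourhood of it
(its values away from that neighbourhood are irrelevant). -/
structure PointedMap where
  toFun : E → E
  map_zero : toFun 0 = 0
  smooth : ∀ᶠ x in 𝓝 (0 : E), ContDiffAt ℝ ∞ toFun x

variable {E}

theorem PointedMap.continuousAt (f : PointedMap E) : ContinuousAt f.toFun 0 :=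
  f.smooth.self_of_nhds.continuousAt

theorem PointedMap.tendsto (f : PointedMap E) : Tendsto f.toFun (𝓝 0) (𝓝 0) := by
  have h := f.continuousAt.tendsto
  rwa [f.map_zero] at h

/-- Composition `f ∘ g`. -/
def PointedMap.comp (f g : PointedMap E) : PointedMap E where
  toFun := f.toFun ∘ g.toFun
  map_zero := by simp [f.map_zero, g.map_zero]
  smooth := by
    filter_upwards [g.smooth, g.tendsto.eventually f.smooth] with x hg hf
    exact hf.comp x hg

/-- A continuous linear map, as a pointed map. -/
def PointedMap.ofLinear (L : E →L[ℝ] E) : PointedMap E where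
  toFun := L
  map_zero := by simp
  smooth := Eventually.of_forall fun _ => L.contDiff.contDiffAt

variable (E)

/-- Two maps have the same germ at the origin if they agree on a neighbourhood of it. -/
instance germSetoid : Setoid (PointedMap E) where
  r f g := f.toFun =ᶠ[𝓝 0] g.toFun
  iseqv := ⟨fun _ => EventuallyEq.rfl, fun h => h.symm, fun h h' => h.trans h'⟩

/-- Germs at the origin of smooth maps `(E, 0) → (E, 0)`. -/
def SmoothGerm : Type _ := Quotient (germSetoid E)

variable {E}

/-- The germ of a pointed map. -/
def germ (f : PointedMap E) : SmoothGerm E := Quotient.mk (germSetoid E) f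

theorem germ_eq_iff {f g : PointedMap E} : germ f = germ g ↔ f.toFun =ᶠ[𝓝 0] g.toFun :=
  Quotient.eq (r := germSetoid E)

theorem germ_surj (φ : SmoothGerm E) : ∃ f, germ f = φ := Quotient.exists_rep φ

/-- Germs form a monoid under composition: `germ f * germ g` is the germ of `f ∘ g`. -/
instance : Monoid (SmoothGerm E) where
  mul := Quotient.map₂ PointedMap.comp (by
    intro f f' hf g g' hg
    have h1 : ∀ᶠ x in 𝓝 (0 : E), f.toFun (g.toFun x) = f'.toFun (g.toFun x) :=
      g.tendsto.eventually hf
    have h2 : ∀ᶠ x in 𝓝 (0 : E), g.toFun x = g'.toFun x := hg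
    change ∀ᶠ x in 𝓝 (0 : E), f.toFun (g.toFun x) = f'.toFun (g'.toFun x)
    filter_upwards [h1, h2] with x h1 h2
    rw [h1, h2])
  one := germ (PointedMap.ofLinear (ContinuousLinearMap.id ℝ E))
  mul_assoc := by
    rintro ⟨f⟩ ⟨g⟩ ⟨h⟩
    rfl
  one_mul := by
    rintro ⟨f⟩
    rfl
  mul_one := by
    rintro ⟨f⟩
    rfl

theorem germ_mul (f g : PointedMap E) : germ f * germ g = germ (f.comp g) := rfl

theorem germ_one : (1 : SmoothGerm E) =
    germ (PointedMap.ofLinear (ContinuousLinearMap.id ℝ E)) := rfl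

variable (E)

/-- The group of germs of local diffeomorphisms of `(E, 0)`: the germs of smooth maps
`(E, 0) → (E, 0)` that have a two-sided inverse germ of the same kind. -/
abbrev DiffeoGerm : Type _ := (SmoothGerm E)ˣ

variable {E}

/-- The germ at the origin of a linear automorphism. -/
def linearGerm (A : E ≃L[ℝ] E) : DiffeoGerm E where
  val := germ (PointedMap.ofLinear (A : E →L[ℝ] E))
  inv := germ (PointedMap.ofLinear (A.symm : E →L[ℝ] E))
  val_inv := germ_eq_iff.2 <| Eventually.of_forall fun x => by
    simp [PointedMap.ofLinear, PointedMap.comp]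
  inv_val := germ_eq_iff.2 <| Eventually.of_forall fun x => by
    simp [PointedMap.ofLinear, PointedMap.comp]

end Germs

/-! ### The focus-focus model -/

/-- `ℝ⁴` with coordinates `(x₁, y₁, x₂, y₂)`. -/
abbrev R4 : Type := Fin 4 → ℝ

/-- `ℝ²` with coordinates `(a, b)`. -/
abbrev R2 : Type := Fin 2 → ℝ

/-- The canonical symplectic form `dx₁ ∧ dy₁ + dx₂ ∧ dy₂`. -/
def omegaCan (u v : R4) : ℝ := (u 0 * v 1 - u 1 * v 0) + (u 2 * v 3 - u 3 * v 2)

/-- The focus-focus model `q = (q₁, q₂)`, `q₁ = x₁ y₂ - x₂ y₁`, `q₂ = x₁ y₁ + x₂ y₂`. -/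
def q (x : R4) : R2 := ![x 0 * x 3 - x 2 * x 1, x 0 * x 1 + x 2 * x 3]

theorem q_tendsto : Tendsto q (𝓝 0) (𝓝 0) := by
  have h : Continuous q := by
    unfold q
    fun_prop
  have h0 : q 0 = 0 := by
    ext i
    fin_cases i <;> simp [q]
  simpa [h0] using h.tendsto 0

/-- The germ `φ` satisfies `φ^* ω_can = ω_can` near the origin. -/
def IsSymplectic (φ : SmoothGerm R4) : Prop :=
  Quotient.liftOn φ
    (fun f => ∀ᶠ x in 𝓝 (0 : R4), ∀ u v : R4,
      omegaCan (fderiv ℝ f.toFun x u) (fderiv ℝ f.toFun x v) = omegaCan u v)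
    (by
      have key : ∀ f g : PointedMap R4, f.toFun =ᶠ[𝓝 0] g.toFun →
          (∀ᶠ x in 𝓝 (0 : R4), ∀ u v : R4,
            omegaCan (fderiv ℝ f.toFun x u) (fderiv ℝ f.toFun x v) = omegaCan u v) →
          ∀ᶠ x in 𝓝 (0 : R4), ∀ u v : R4,
            omegaCan (fderiv ℝ g.toFun x u) (fderiv ℝ g.toFun x v) = omegaCan u v := by
        intro f g h hf
        filter_upwards [h.fderiv (𝕜 := ℝ), hf] with x h1 h2
        rw [← h1]
        exact h2
      intro f g h
      exact propext ⟨key f g h, key g f (EventuallyEq.symm h)⟩)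

theorem isSymplectic_germ (f : PointedMap R4) : IsSymplectic (germ f) ↔
    ∀ᶠ x in 𝓝 (0 : R4), ∀ u v : R4,
      omegaCan (fderiv ℝ f.toFun x u) (fderiv ℝ f.toFun x v) = omegaCan u v := Iff.rfl

/-- The relation `q ∘ φ = g ∘ q` between germs at the origin of `ℝ⁴`. -/
def Intertwines (φ : SmoothGerm R4) (g : SmoothGerm R2) : Prop :=
  Quotient.liftOn₂ φ g
    (fun f k => ∀ᶠ x in 𝓝 (0 : R4), q (f.toFun x) = k.toFun (q x))
    (by
      have key : ∀ (f f' : PointedMap R4) (k k' : PointedMap R2), f.toFun =ᶠ[𝓝 0] f'.toFun →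
          k.toFun =ᶠ[𝓝 0] k'.toFun →
          (∀ᶠ x in 𝓝 (0 : R4), q (f.toFun x) = k.toFun (q x)) →
          ∀ᶠ x in 𝓝 (0 : R4), q (f'.toFun x) = k'.toFun (q x) := by
        intro f f' k k' hf hk h
        filter_upwards [hf, q_tendsto.eventually hk, h] with x h1 h2 h3
        rw [← h1, h3, h2]
      intro f k f' k' hf hk
      exact propext ⟨key f f' k k' hf hk,
        key f' f k' k (EventuallyEq.symm hf) (EventuallyEq.symm hk)⟩)

theorem intertwines_germ (f : PointedMap R4) (k : PointedMap R2) :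
    Intertwines (germ f) (germ k) ↔
      ∀ᶠ x in 𝓝 (0 : R4), q (f.toFun x) = k.toFun (q x) := Iff.rfl

theorem IsSymplectic.one : IsSymplectic 1 := by
  rw [germ_one, isSymplectic_germ]
  refine Eventually.of_forall fun x u v => ?_
  simp [PointedMap.ofLinear]

theorem IsSymplectic.mul {φ ψ : SmoothGerm R4} (hφ : IsSymplectic φ) (hψ : IsSymplectic ψ) :
    IsSymplectic (φ * ψ) := by
  obtain ⟨f, rfl⟩ := germ_surj φ
  obtain ⟨g, rfl⟩ := germ_surj ψ
  rw [isSymplectic_germ] at hφ hψ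
  rw [germ_mul, isSymplectic_germ]
  filter_upwards [g.tendsto.eventually hφ, hψ, g.smooth, g.tendsto.eventually f.smooth]
    with x h1 h2 h3 h4 u v
  have e : fderiv ℝ (f.toFun ∘ g.toFun) x
      = (fderiv ℝ f.toFun (g.toFun x)).comp (fderiv ℝ g.toFun x) :=
    fderiv_comp x (h4.differentiableAt (by simp)) (h3.differentiableAt (by simp))
  change omegaCan (fderiv ℝ (f.toFun ∘ g.toFun) x u) (fderiv ℝ (f.toFun ∘ g.toFun) x v) = _
  rw [e]
  simp only [ContinuousLinearMap.comp_apply]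
  rw [h1, h2]

theorem IsSymplectic.of_mul {φ ψ : SmoothGerm R4} (hφ : IsSymplectic φ)
    (h : IsSymplectic (φ * ψ)) : IsSymplectic ψ := by
  obtain ⟨f, rfl⟩ := germ_surj φ
  obtain ⟨g, rfl⟩ := germ_surj ψ
  rw [isSymplectic_germ] at hφ
  rw [germ_mul, isSymplectic_germ] at h
  rw [isSymplectic_germ]
  filter_upwards [g.tendsto.eventually hφ, h, g.smooth, g.tendsto.eventually f.smooth]
    with x h1 h2 h3 h4 u v
  have e : fderiv ℝ (f.toFun ∘ g.toFun) x
      = (fderiv ℝ f.toFun (g.toFun x)).comp (fderiv ℝ g.toFun x) :=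
    fderiv_comp x (h4.differentiableAt (by simp)) (h3.differentiableAt (by simp))
  have h5 := h2 u v
  change omegaCan (fderiv ℝ (f.toFun ∘ g.toFun) x u)
    (fderiv ℝ (f.toFun ∘ g.toFun) x v) = _ at h5
  rw [e] at h5
  simp only [ContinuousLinearMap.comp_apply] at h5
  rw [h1] at h5
  exact h5

theorem Intertwines.one : Intertwines 1 1 := by
  rw [germ_one, germ_one, intertwines_germ]
  exact Eventually.of_forall fun x => rfl

theorem Intertwines.mul {φ ψ : SmoothGerm R4} {g k : SmoothGerm R2} (h : Intertwines φ g)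
    (h' : Intertwines ψ k) : Intertwines (φ * ψ) (g * k) := by
  obtain ⟨f, rfl⟩ := germ_surj φ
  obtain ⟨f', rfl⟩ := germ_surj ψ
  obtain ⟨g, rfl⟩ := germ_surj g
  obtain ⟨g', rfl⟩ := germ_surj k
  rw [intertwines_germ] at h h'
  rw [germ_mul, germ_mul, intertwines_germ]
  filter_upwards [f'.tendsto.eventually h, h'] with x h1 h2
  change q (f.toFun (f'.toFun x)) = g.toFun (g'.toFun (q x))
  rw [h1, h2]

theorem Intertwines.inv {φ : DiffeoGerm R4} {g : DiffeoGerm R2}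
    (h : Intertwines φ.val g.val) : Intertwines (φ⁻¹).val (g⁻¹).val := by
  obtain ⟨f, hf⟩ := germ_surj φ.val
  obtain ⟨f', hf'⟩ := germ_surj (φ⁻¹).val
  obtain ⟨k, hk⟩ := germ_surj g.val
  obtain ⟨k', hk'⟩ := germ_surj (g⁻¹).val
  have e1 : germ (f.comp f') = 1 := by rw [← germ_mul, hf, hf']; simp
  have e2 : germ (k'.comp k) = 1 := by rw [← germ_mul, hk, hk']; simp
  rw [germ_one, germ_eq_iff] at e1 e2
  rw [← hf, ← hk, intertwines_germ] at h
  rw [← hf', ← hk', intertwines_germ]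
  have t : Tendsto (fun x => q (f'.toFun x)) (𝓝 0) (𝓝 0) := q_tendsto.comp f'.tendsto
  filter_upwards [e1, f'.tendsto.eventually h, t.eventually e2] with x h1 h2 h3
  change f.toFun (f'.toFun x) = x at h1
  change k'.toFun (k.toFun (q (f'.toFun x))) = q (f'.toFun x) at h3
  rw [h1] at h2
  rw [h2, h3]

/-- `Aut((ℝ⁴, 0), ω_can, q)`: the group of germs of symplectomorphisms `φ` of `(ℝ⁴, 0)` for which
there is a germ of local diffeomorphism `g` of `(ℝ², 0)` with `q ∘ φ = g ∘ q`. -/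
def Aut : Subgroup (DiffeoGerm R4) where
  carrier := {φ | IsSymplectic φ.val ∧ ∃ g : DiffeoGerm R2, Intertwines φ.val g.val}
  one_mem' := ⟨IsSymplectic.one, 1, Intertwines.one⟩
  mul_mem' := by
    rintro φ ψ ⟨h1, g, h2⟩ ⟨h3, k, h4⟩
    exact ⟨h1.mul h3, g * k, h2.mul h4⟩
  inv_mem' := by
    rintro φ ⟨h1, g, h2⟩
    refine ⟨IsSymplectic.of_mul h1 ?_, g⁻¹, h2.inv⟩
    rw [Units.mul_inv]
    exact IsSymplectic.one

/-! ### The group `G` -/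

/-- A flat function near the origin of `ℝ²`: smooth on a neighbourhood of the origin, with
vanishing Taylor series there. -/
def IsFlat (h : R2 → ℝ) : Prop :=
  (∀ᶠ c in 𝓝 (0 : R2), ContDiffAt ℝ ∞ h c) ∧ ∀ n : ℕ, iteratedFDeriv ℝ n h 0 = 0

/-- The germ `g` is of the form `g(a, b) = (ε₁ a, ε₂ b + O(∞))`, with signs `ε₁, ε₂`. -/
def HasFlatForm (g : SmoothGerm R2) : Prop :=
  ∃ k : PointedMap R2, germ k = g ∧ ∃ (ε : ℤˣ × ℤˣ) (h : R2 → ℝ), IsFlat h ∧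
    ∀ᶠ c in 𝓝 (0 : R2), k.toFun c = ![((ε.1 : ℤ) : ℝ) * c 0, ((ε.2 : ℤ) : ℝ) * c 1 + h c]

theorem IsFlat.add {h k : R2 → ℝ} (hh : IsFlat h) (hk : IsFlat k) : IsFlat (h + k) := by
  refine ⟨?_, fun n => ?_⟩
  · filter_upwards [hh.1, hk.1] with c h1 h2
    exact h1.add h2
  · have e := iteratedFDeriv_add_apply (𝕜 := ℝ) (i := n) (x := (0 : R2)) (f := h) (g := k)
      (hh.1.self_of_nhds.of_le (by exact_mod_cast le_top))
      (hk.1.self_of_nhds.of_le (by exact_mod_cast le_top))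
    rw [e, hh.2 n, hk.2 n, add_zero]

theorem IsFlat.const_mul {h : R2 → ℝ} (hh : IsFlat h) (r : ℝ) : IsFlat (r • h) := by
  refine ⟨?_, fun n => ?_⟩
  · filter_upwards [hh.1] with c h1
    exact h1.const_smul r
  · have e := iteratedFDeriv_const_smul_apply (𝕜 := ℝ) (i := n) (x := (0 : R2)) (f := h) (a := r)
      (hh.1.self_of_nhds.of_le (by exact_mod_cast le_top))
    rw [e, hh.2 n, smul_zero]

theorem IsFlat.comp {h : R2 → ℝ} (hh : IsFlat h) (k : PointedMap R2) :
    IsFlat (h ∘ k.toFun) := by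
  refine ⟨?_, fun n => ?_⟩
  · filter_upwards [k.smooth, k.tendsto.eventually hh.1] with c h1 h2
    exact h2.comp c h1
  · have h0 : ContDiffAt ℝ ∞ h (k.toFun 0) := by
      rw [k.map_zero]
      exact hh.1.self_of_nhds
    rw [iteratedFDeriv_comp h0 k.smooth.self_of_nhds (i := n) (by exact_mod_cast le_top)]
    refine Finset.sum_eq_zero fun c _ => ?_
    ext v
    simp [ftaylorSeries, k.map_zero, hh.2, FormalMultilinearSeries.compAlongOrderedFinpartition]

theorem HasFlatForm.mul {g g' : SmoothGerm R2} (hg : HasFlatForm g) (hg' : HasFlatForm g') :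
    HasFlatForm (g * g') := by
  obtain ⟨k, rfl, ε, h, hh, e⟩ := hg
  obtain ⟨k', rfl, ε', h', hh', e'⟩ := hg'
  refine ⟨k.comp k', rfl, ε * ε', (((ε.2 : ℤ) : ℝ) • h') + h ∘ k'.toFun,
    (hh'.const_mul _).add (hh.comp k'), ?_⟩
  filter_upwards [k'.tendsto.eventually e, e'] with c h1 h2
  change k.toFun (k'.toFun c) = _
  rw [h1]
  ext i
  fin_cases i
  · simp [h2, mul_assoc]
  · simp [h2, mul_add, mul_assoc, add_assoc]

theorem HasFlatForm.inv {g : DiffeoGerm R2} (hg : HasFlatForm g.val) :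
    HasFlatForm (g⁻¹).val := by
  obtain ⟨k, hk, ε, h, hh, e⟩ := hg
  obtain ⟨k', hk'⟩ := germ_surj (g⁻¹).val
  have e1 : germ (k.comp k') = 1 := by rw [← germ_mul, hk, hk']; simp
  rw [germ_one, germ_eq_iff] at e1
  refine ⟨k', hk', ε, (-((ε.2 : ℤ) : ℝ)) • (h ∘ k'.toFun), (hh.comp k').const_mul _, ?_⟩
  filter_upwards [k'.tendsto.eventually e, e1] with c h1 h2
  change k.toFun (k'.toFun c) = c at h2
  rw [h2] at h1
  have a := congrFun h1 0
  have b := congrFun h1 1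
  simp only [Matrix.cons_val_zero, Matrix.cons_val_one] at a b
  have s : ∀ u : ℤˣ, ((u : ℤ) : ℝ) * ((u : ℤ) : ℝ) = 1 := by
    intro u
    exact_mod_cast Int.units_coe_mul_self u
  ext i
  fin_cases i
  · change k'.toFun c 0 = ((ε.1 : ℤ) : ℝ) * c 0
    rw [a, ← mul_assoc, s, one_mul]
  · change k'.toFun c 1 = ((ε.2 : ℤ) : ℝ) * c 1 + -((ε.2 : ℤ) : ℝ) * h (k'.toFun c)
    rw [b, mul_add, ← mul_assoc, s]
    ring

/-- The group `G` of germs of local diffeomorphisms of `(ℝ², 0)` of the form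
`(a, b) ↦ (±a, ±b + O(∞))`. -/
def G : Subgroup (DiffeoGerm R2) where
  carrier := {g | HasFlatForm g.val}
  one_mem' := ⟨_, rfl, 1, 0,
    ⟨Eventually.of_forall fun _ => contDiffAt_const, fun n => by
      simp⟩,
    Eventually.of_forall fun c => by
      ext i
      fin_cases i <;> simp [PointedMap.ofLinear]⟩
  mul_mem' := fun h h' => HasFlatForm.mul h h'
  inv_mem' := fun h => HasFlatForm.inv h

/-! ### Explicit linear maps -/

/-- `A₁₀ (x₁, y₁, x₂, y₂) = (x₂, y₂, x₁, y₁)`. -/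
noncomputable def A10 : R4 ≃L[ℝ] R4 := LinearEquiv.toContinuousLinearEquiv
  { toFun := fun x => ![x 2, x 3, x 0, x 1]
    invFun := fun x => ![x 2, x 3, x 0, x 1]
    map_add' := fun x y => by ext i; fin_cases i <;> simp
    map_smul' := fun r x => by ext i; fin_cases i <;> simp
    left_inv := fun x => by ext i; fin_cases i <;> simp
    right_inv := fun x => by ext i; fin_cases i <;> simp }

/-- `A₀₁ (x₁, y₁, x₂, y₂) = (y₁, -x₁, y₂, -x₂)`. -/
noncomputable def A01 : R4 ≃L[ℝ] R4 := LinearEquiv.toContinuousLinearEquiv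
  { toFun := fun x => ![x 1, -x 0, x 3, -x 2]
    invFun := fun x => ![-x 1, x 0, -x 3, x 2]
    map_add' := fun x y => by ext i; fin_cases i <;> simp <;> ring
    map_smul' := fun r x => by ext i; fin_cases i <;> simp
    left_inv := fun x => by ext i; fin_cases i <;> simp
    right_inv := fun x => by ext i; fin_cases i <;> simp }

/-- The map `A_ε` attached to a pair of signs: `A₁₀` is used when `ε₁ = -1`, and `A₀₁` when
`ε₂ = -1`; so `A_(-1,-1) = A₁₀ ∘ A₀₁`. -/
noncomputable def A (ε : ℤˣ × ℤˣ) : R4 ≃L[ℝ] R4 :=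
  (if ε.1 = -1 then A10 else 1) * (if ε.2 = -1 then A01 else 1)

/-- `g_ε (a, b) = (ε₁ a, ε₂ b)`. -/
noncomputable def signMap (ε : ℤˣ × ℤˣ) : R2 ≃L[ℝ] R2 := LinearEquiv.toContinuousLinearEquiv
  { toFun := fun c => ![((ε.1 : ℤ) : ℝ) * c 0, ((ε.2 : ℤ) : ℝ) * c 1]
    invFun := fun c => ![((ε.1 : ℤ) : ℝ) * c 0, ((ε.2 : ℤ) : ℝ) * c 1]
    map_add' := fun x y => by ext i; fin_cases i <;> simp <;> ring
    map_smul' := fun r x => by ext i; fin_cases i <;> simp <;> ring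
    left_inv := fun x => by
      have s : ∀ u : ℤˣ, ((u : ℤ) : ℝ) * ((u : ℤ) : ℝ) = 1 := fun u => by
        exact_mod_cast Int.units_coe_mul_self u
      ext i
      fin_cases i <;> simp [← mul_assoc, s]
    right_inv := fun x => by
      have s : ∀ u : ℤˣ, ((u : ℤ) : ℝ) * ((u : ℤ) : ℝ) = 1 := fun u => by
        exact_mod_cast Int.units_coe_mul_self u
      ext i
      fin_cases i <;> simp [← mul_assoc, s] }

end FocusFocus

/-!
In the complex coordinates `z = x₁ + i x₂` and `w = y₁ + i y₂` the model is
`q₂ + i q₁ = conj z * w`, and the joint Hamiltonian flow of `(q₁, q₂)` is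
`(z, w) ↦ (exp ζ * z, exp (-conj ζ) * w)` for a complex time `ζ`. If `q ∘ φ = g ∘ q`, then `φ`
conjugates the flow of `a q₁ + b q₂` to a flow of the same kind, whose times are the covector
transported by the derivative of `g`.

*Necessity.* The Hamiltonian flow of `q₁` is `2π`-periodic, so the periods of `q₁` and of its
transport agree up to sign: the first component of `g` is `± a`. On the fibre over `c ≠ 0`, the flow
of `q₂` needs a time `-log |c| + O(1)`, with a smooth remainder, to pass the singular point from a
section near the stable plane `z = 0` to a section near the unstable plane `w = 0`. Comparing the
passage through the image of such sections, one finds a linear relation between `log |c|` and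
`log |g c|` whose coefficients are partial derivatives of `g`, up to a smooth error. On a ray
through the origin `log |c|` has no smooth expansion, while the logarithm of `|g c| / |c|` expands
with coefficients that are not polynomial in the slope of the ray unless `g` is trivial to that
order. So the second component of `g` is `± b` plus a flat function.

*Sufficiency.* If `h` is flat, `(z, w) ↦ (z, w + h(q) z / |z|²)` lifts `(a, b) ↦ (a, b + h(a, b))`.
It fails to be symplectic, but composing it with the joint flow for the times
`mᵢ(q) log |z|² / 2`, where `dh + m₁ d(b + h) = m₂ da`, repairs this without changing `q`. Flatness
of `h`, `m₁` and `m₂` makes all the terms smooth across `z = 0`, because `|q|² = |z|² |w|²`. The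
signs are realised by the linear maps `A_ε`.
-/

namespace FocusFocus

/-! ### Vanishing to infinite order -/

section Bump

variable {E F : Type*} [NormedAddCommGroup E] [NormedSpace ℝ E]
  [NormedAddCommGroup F] [NormedSpace ℝ F]

theorem exists_contDiff_eventuallyEq [FiniteDimensional ℝ E] {f : E → F} {x₀ : E}
    (hf : ∀ᶠ x in 𝓝 x₀, ContDiffAt ℝ ∞ f x) : ∃ g : E → F, ContDiff ℝ ∞ g ∧ g =ᶠ[𝓝 x₀] f := by
  obtain ⟨ε, hε, hball⟩ := Metric.eventually_nhds_iff_ball.1 hf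
  let b : ContDiffBump x₀ := ⟨ε / 3, ε / 2, by positivity, by linarith⟩
  refine ⟨fun x => b x • f x, contDiff_iff_contDiffAt.2 fun x => ?_, ?_⟩
  · by_cases hx : x ∈ Metric.ball x₀ ε
    · exact b.contDiffAt.smul (hball x hx)
    · have hx' : x ∉ tsupport b := by
        rw [b.tsupport_eq, Metric.mem_closedBall, not_le]
        rw [Metric.mem_ball, not_lt] at hx
        exact (half_lt_self hε).trans_le hx
      refine (contDiffAt_const (c := 0)).congr_of_eventuallyEq ?_
      filter_upwards [notMem_tsupport_iff_eventuallyEq.1 hx'] with y hy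
      rw [hy, Pi.zero_apply, zero_smul]
  · filter_upwards [b.eventuallyEq_one] with x hx
    rw [hx, Pi.one_apply, one_smul]

end Bump

section InfiniteOrder

variable {D E F : Type*} [NormedAddCommGroup D] [NormedAddCommGroup E] [NormedAddCommGroup F]
  {f g : E → F}

/-- `f` is `O(‖x‖ⁿ)` at the origin for every `n`. For a smooth `f` this means that the Taylor series
of `f` at the origin is zero, see `vanishesToInfiniteOrder_iff`. -/
def VanishesToInfiniteOrder (f : E → F) : Prop :=
  ∀ n : ℕ, f =O[𝓝 0] fun x => ‖x‖ ^ n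

namespace VanishesToInfiniteOrder

theorem apply_zero (h : VanishesToInfiniteOrder f) : f 0 = 0 :=
  Asymptotics.IsBigO.eq_zero_of_norm_pow (by simpa only [sub_zero] using h 1) one_ne_zero

theorem congr (h : VanishesToInfiniteOrder f) (hfg : f =ᶠ[𝓝 0] g) : VanishesToInfiniteOrder g :=
  fun n => (h n).congr' hfg EventuallyEq.rfl

theorem add (hf : VanishesToInfiniteOrder f) (hg : VanishesToInfiniteOrder g) :
    VanishesToInfiniteOrder fun x => f x + g x :=
  fun n => (hf n).add (hg n)

theorem sub (hf : VanishesToInfiniteOrder f) (hg : VanishesToInfiniteOrder g) :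
    VanishesToInfiniteOrder fun x => f x - g x :=
  fun n => (hf n).sub (hg n)

theorem mul_of_continuousAt {k l : E → ℝ} (hk : VanishesToInfiniteOrder k)
    (hl : ContinuousAt l 0) : VanishesToInfiniteOrder fun x => k x * l x := fun n => by
  simpa only [mul_one] using (hk n).mul (hl.isBigO_one ℝ)

theorem comp_isBigO {k : D → E} (h : VanishesToInfiniteOrder f) (hk : Tendsto k (𝓝 0) (𝓝 0))
    (hk' : k =O[𝓝 0] fun x => ‖x‖) : VanishesToInfiniteOrder fun x => f (k x) := fun n =>
  ((h n).comp_tendsto hk).trans (hk'.norm_left.pow n)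

end VanishesToInfiniteOrder

variable [NormedSpace ℝ D] [NormedSpace ℝ E]

theorem VanishesToInfiniteOrder.comp_continuousLinearMap (h : VanishesToInfiniteOrder f)
    (L : D →L[ℝ] E) : VanishesToInfiniteOrder fun x => f (L x) :=
  h.comp_isBigO (L.continuous.tendsto' 0 0 L.map_zero) (L.isBigO_id (𝓝 0)).norm_right

variable [NormedSpace ℝ F]

theorem isBigO_sub_sub_fderiv {x₀ : E} (hf : ContDiffAt ℝ 2 f x₀) :
    (fun p : E × E => f p.2 - f p.1 - fderiv ℝ f p.1 (p.2 - p.1)) =O[𝓝 (x₀, x₀)]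
      fun p => ‖p.2 - p.1‖ ^ 2 := by
  obtain ⟨K, t, ht, hK⟩ := (hf.fderiv_right (m := 1) le_rfl).exists_lipschitzOnWith
  obtain ⟨ε, hε, hball⟩ := Metric.eventually_nhds_iff_ball.1
    ((hf.eventually (by simp)).and (eventually_mem_set.2 ht))
  refine Asymptotics.IsBigO.of_bound K ?_
  rw [nhds_prod_eq]
  filter_upwards [prod_mem_prod (Metric.ball_mem_nhds x₀ hε) (Metric.ball_mem_nhds x₀ hε)]
    with ⟨x, y⟩ ⟨hx, hy⟩
  have segment_subset := (convex_ball x₀ ε).segment_subset hx hy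
  have h := (convex_segment x y).norm_image_sub_le_of_norm_hasFDerivWithin_le'
    (C := K * ‖y - x‖) (φ := fderiv ℝ f x)
    (fun z hz => ((hball z (segment_subset hz)).1.differentiableAt
      two_ne_zero).hasFDerivAt.hasFDerivWithinAt)
    (fun z hz => (hK.norm_sub_le (hball z (segment_subset hz)).2 (hball x hx).2).trans
      (mul_le_mul_of_nonneg_left (norm_sub_le_of_mem_segment hz) K.coe_nonneg))
    (left_mem_segment ℝ x y) (right_mem_segment ℝ x y)
  simpa only [norm_pow, norm_norm, pow_two, mul_assoc, norm_mul] using h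

-- As in the inequality of Landau, `Df(x) (‖x‖ⁿ⁺¹ v)` is an increment of `f`, which is tiny, up to
-- an error that is quadratic in `‖x‖ⁿ⁺¹`.
theorem VanishesToInfiniteOrder.fderiv_apply (hf : ContDiffAt ℝ 2 f 0)
    (h : VanishesToInfiniteOrder f) (v : E) :
    VanishesToInfiniteOrder fun x => fderiv ℝ f x v := fun n => by
  set δ : E → E := fun x => ‖x‖ ^ (n + 1) • v with hδ
  have δ_isBigO : δ =O[𝓝 0] fun x => ‖x‖ ^ (n + 1) :=
    Asymptotics.IsBigO.of_bound ‖v‖ (Eventually.of_forall fun x => by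
      rw [hδ, norm_smul, mul_comm])
  have pow_isBigO (m : ℕ) : (fun x : E => ‖x‖ ^ (m + 1)) =O[𝓝 0] fun x => ‖x‖ ^ m :=
    (Asymptotics.isLittleO_pow_pow m.lt_succ_self).isBigO.comp_tendsto tendsto_norm_zero
  have δ_isBigO_norm : δ =O[𝓝 0] fun x => ‖x‖ := by
    refine δ_isBigO.trans ?_
    have : ContinuousAt (fun x : E => ‖x‖ ^ n) 0 := by fun_prop
    simpa only [pow_succ, one_mul] using
      (this.isBigO_one ℝ).mul (Asymptotics.isBigO_refl (fun x : E => ‖x‖) (𝓝 0))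
  have shift_tendsto : Tendsto (fun x => x + δ x) (𝓝 0) (𝓝 0) :=
    Continuous.tendsto' (by fun_prop) 0 0 (by simp [hδ])
  have shift : VanishesToInfiniteOrder fun x => f (x + δ x) :=
    h.comp_isBigO shift_tendsto
      ((Asymptotics.isBigO_refl _ _).norm_right.add δ_isBigO_norm)
  have taylor : (fun x => f (x + δ x) - f x - fderiv ℝ f x (δ x)) =O[𝓝 0]
      fun x => (‖x‖ ^ (n + 1)) ^ 2 := by
    have := (isBigO_sub_sub_fderiv hf).comp_tendsto (tendsto_id.prodMk_nhds shift_tendsto)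
    simp only [Function.comp_def, id, add_sub_cancel_left] at this
    exact this.trans (δ_isBigO.norm_left.pow 2)
  have increment : (fun x => fderiv ℝ f x (δ x)) =O[𝓝 0] fun x => (‖x‖ ^ (n + 1)) ^ 2 := by
    have := shift.sub h ((n + 1) * 2)
    simp only [pow_mul _ (n + 1)] at this
    simpa only [sub_sub_cancel] using this.sub taylor
  have fderiv_zero : fderiv ℝ f 0 = 0 :=
    (Asymptotics.IsBigO.hasFDerivAt (n := 2) (by simpa only [sub_zero] using h 2)
      one_lt_two).fderiv
  obtain ⟨C, hC⟩ := increment.bound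
  refine (Asymptotics.IsBigO.of_bound C ?_).trans (pow_isBigO n)
  filter_upwards [hC] with x hx
  rcases eq_or_ne x 0 with rfl | hx0
  · simp [fderiv_zero]
  · rw [map_smul, norm_smul, pow_two, norm_mul, mul_left_comm] at hx
    exact le_of_mul_le_mul_left hx (norm_pos_iff.2 (pow_ne_zero _ (norm_ne_zero_iff.2 hx0)))

theorem VanishesToInfiniteOrder.iteratedFDeriv_eq_zero (hf : ContDiffAt ℝ ∞ f 0)
    (h : VanishesToInfiniteOrder f) (n : ℕ) : iteratedFDeriv ℝ n f 0 = 0 := by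
  induction n generalizing f with
  | zero => ext v; simp [h.apply_zero]
  | succ n ih =>
    ext v
    have hf' : ContDiffAt ℝ ∞ (fderiv ℝ f) 0 := hf.fderiv_right (by simp)
    have partial_deriv := ih (f := fun x => fderiv ℝ f x (v (Fin.last n)))
      (hf'.clm_apply contDiffAt_const)
      (h.fderiv_apply (hf.of_le (WithTop.coe_le_coe.2 le_top)) _)
    have := (ContinuousLinearMap.apply ℝ F (v (Fin.last n))).iteratedFDeriv_comp_left
      (i := n) hf' (by exact_mod_cast le_top)
    rw [iteratedFDeriv_succ_apply_right]
    have := congrArg (fun M => M (Fin.init v)) (this.symm.trans partial_deriv)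
    simpa using this

theorem iteratedDeriv_comp_smul_const {n : ℕ} (hf : ContDiff ℝ n f) (c : E) (r : ℝ) :
    iteratedDeriv n (fun s : ℝ => f (s • c)) r = iteratedFDeriv ℝ n f (r • c) fun _ => c := by
  have := (ContinuousLinearMap.toSpanSingleton ℝ c).iteratedFDeriv_comp_right hf r le_rfl
  rw [iteratedDeriv_eq_iteratedFDeriv]
  simpa [Function.comp_def] using congrArg (fun M => M fun _ => 1) this

theorem isBigO_pow_of_iteratedFDeriv_apply_const_eq_zero {n : ℕ} (hf : ContDiff ℝ n f)
    (h : ∀ k < n, ∀ c, (iteratedFDeriv ℝ k f 0 fun _ => c) = 0) :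
    f =O[𝓝 0] fun x => ‖x‖ ^ n := by
  cases n with
  | zero => simpa only [pow_zero] using hf.continuous.continuousAt.isBigO_one ℝ
  | succ n =>
  obtain ⟨C, hC⟩ :=
    (((hf.continuous_iteratedFDeriv le_rfl).continuousAt (x := 0)).isBigO_one ℝ).bound
  obtain ⟨ε, hε, hball⟩ := Metric.eventually_nhds_iff_ball.1 hC
  refine Asymptotics.IsBigO.of_bound (C / n.factorial) ?_
  filter_upwards [Metric.ball_mem_nhds (0 : E) hε] with x hx
  have hray : ContDiff ℝ (n + 1) fun s : ℝ => f (s • x) :=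
    hf.comp (contDiff_id.smul contDiff_const)
  have iteratedDeriv_ray (k : ℕ) (hk : k ≤ n + 1) {r : ℝ} (hr : r ∈ Set.Icc (0 : ℝ) 1) :
      iteratedDerivWithin k (fun s : ℝ => f (s • x)) (Set.Icc 0 1) r
        = iteratedFDeriv ℝ k f (r • x) fun _ => x := by
    have hk' : (k : WithTop ℕ∞) ≤ n + 1 := by exact_mod_cast hk
    rw [iteratedDerivWithin_eq_iteratedDeriv (uniqueDiffOn_Icc zero_lt_one)
      (hray.of_le hk').contDiffAt hr, iteratedDeriv_comp_smul_const (hf.of_le hk')]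
  have remainder := taylor_mean_remainder_bound zero_le_one (hray.contDiffOn (s := Set.Icc 0 1))
    (Set.right_mem_Icc.2 zero_le_one) (C := C * ‖x‖ ^ (n + 1)) fun r hr => by
      have hrx : r • x ∈ Metric.ball 0 ε :=
        (convex_ball 0 ε).smul_mem_of_zero_mem (Metric.mem_ball_self hε) hx hr
      rw [iteratedDeriv_ray _ le_rfl hr]
      refine (ContinuousMultilinearMap.le_opNorm _ _).trans ?_
      rw [Finset.prod_const, Finset.card_univ, Fintype.card_fin]
      gcongr
      simpa only [norm_one, mul_one] using hball _ hrx
  rw [taylor_within_apply, Finset.sum_eq_zero fun k hk => ?_] at remainder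
  · simpa [div_mul_eq_mul_div] using remainder
  · have hk : k < n + 1 := Finset.mem_range.1 hk
    rw [iteratedDeriv_ray k hk.le (Set.left_mem_Icc.2 zero_le_one), zero_smul, h k hk, smul_zero]

theorem vanishesToInfiniteOrder_of_iteratedFDeriv_apply_const (hf : ContDiff ℝ ∞ f)
    (h : ∀ n c, (iteratedFDeriv ℝ n f 0 fun _ => c) = 0) : VanishesToInfiniteOrder f := fun _ =>
  isBigO_pow_of_iteratedFDeriv_apply_const_eq_zero (hf.of_le (WithTop.coe_le_coe.2 le_top))
    fun k _ => h k

theorem vanishesToInfiniteOrder_iff (hf : ContDiff ℝ ∞ f) :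
    VanishesToInfiniteOrder f ↔ ∀ n, iteratedFDeriv ℝ n f 0 = 0 :=
  ⟨fun h n => h.iteratedFDeriv_eq_zero hf.contDiffAt n, fun h =>
    vanishesToInfiniteOrder_of_iteratedFDeriv_apply_const hf fun n c => by simp [h n]⟩

theorem vanishesToInfiniteOrder_of_rays (hf : ContDiff ℝ ∞ f) {s : Set E} (hs : Dense s)
    (h : ∀ c ∈ s, VanishesToInfiniteOrder fun r : ℝ => f (r • c)) : VanishesToInfiniteOrder f := by
  refine vanishesToInfiniteOrder_of_iteratedFDeriv_apply_const hf fun n => congrFun ?_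
  refine Continuous.ext_on hs (by fun_prop) continuous_const fun c hc => ?_
  have hray : ContDiff ℝ ∞ fun r : ℝ => f (r • c) := hf.comp (contDiff_id.smul contDiff_const)
  rw [← zero_smul ℝ c,
    ← iteratedDeriv_comp_smul_const (hf.of_le (WithTop.coe_le_coe.2 le_top)),
    iteratedDeriv_eq_iteratedFDeriv, (h c hc).iteratedFDeriv_eq_zero hray.contDiffAt]
  rfl

end InfiniteOrder

/-! ### Smooth functions of one variable -/

section OneVariable

variable {F : Type*} [NormedAddCommGroup F]

theorem VanishesToInfiniteOrder.isLittleO_pow {f : ℝ → F} (h : VanishesToInfiniteOrder f)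
    (n : ℕ) : f =o[𝓝 0] fun r => r ^ n := by
  have hsucc : f =O[𝓝 0] fun r => r ^ (n + 1) := by
    simpa only [← norm_pow, Asymptotics.isBigO_norm_right] using h (n + 1)
  exact hsucc.trans_isLittleO (Asymptotics.isLittleO_pow_pow n.lt_succ_self)

theorem VanishesToInfiniteOrder.tendsto_div_pow {f : ℝ → ℝ} (h : VanishesToInfiniteOrder f)
    (n : ℕ) : Tendsto (fun r => f r / r ^ n) (𝓝[≠] 0) (𝓝 0) :=
  (h.isLittleO_pow n).tendsto_div_nhds_zero.mono_left nhdsWithin_le_nhds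

variable [NormedSpace ℝ F]

theorem vanishesToInfiniteOrder_of_eq_pow_smul {f : ℝ → F}
    (h : ∀ n : ℕ, ∃ g : ℝ → F, ContinuousAt g 0 ∧ ∀ r, f r = r ^ n • g r) :
    VanishesToInfiniteOrder f := fun n => by
  obtain ⟨g, hg, hfg⟩ := h n
  have hbound := (Asymptotics.isBigO_refl (fun r : ℝ => r ^ n) (𝓝 0)).smul (hg.isBigO_one ℝ)
  simpa only [← hfg, smul_eq_mul, mul_one, ← norm_pow, Asymptotics.isBigO_norm_right] using hbound

theorem hasDerivAt_intervalIntegral {f : ℝ → ℝ → F} (hf : ContDiff ℝ 1 (Function.uncurry f))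
    (a b r : ℝ) : HasDerivAt (fun r => ∫ t in a..b, f r t)
      (∫ t in a..b, fderiv ℝ (Function.uncurry f) (r, t) (1, 0)) r := by
  have hf' : Continuous fun p : ℝ × ℝ => fderiv ℝ (Function.uncurry f) p (1, 0) :=
    (hf.continuous_fderiv one_ne_zero).clm_apply continuous_const
  have hc : Continuous (Function.uncurry f) := hf.continuous
  obtain ⟨K, hK⟩ := ((isCompact_closedBall r 1).prod
    (isCompact_uIcc (a := a) (b := b))).exists_bound_of_continuousOn hf'.continuousOn
  refine (intervalIntegral.hasDerivAt_integral_of_dominated_loc_of_deriv_le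
    (F' := fun x t => fderiv ℝ (Function.uncurry f) (x, t) (1, 0)) (bound := fun _ => K)
    (Metric.ball_mem_nhds r one_pos)
    (Eventually.of_forall fun x => (hc.comp (by fun_prop : Continuous fun t => (x, t)))
      |>.aestronglyMeasurable)
    ((hc.comp (by fun_prop : Continuous fun t => (r, t))).intervalIntegrable _ _)
    (hf'.comp (by fun_prop : Continuous fun t => (r, t))).aestronglyMeasurable
    (Eventually.of_forall fun t ht x hx =>
      hK (x, t) ⟨Metric.ball_subset_closedBall hx, Set.uIoc_subset_uIcc ht⟩)
    intervalIntegrable_const (Eventually.of_forall fun t _ x _ => ?_)).2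
  exact (hf.differentiable one_ne_zero (x, t)).hasFDerivAt.comp_hasDerivAt x
    ((hasDerivAt_id x).prodMk (hasDerivAt_const x t))

theorem contDiff_intervalIntegral {f : ℝ → ℝ → F} (hf : ContDiff ℝ ∞ (Function.uncurry f))
    (a b : ℝ) : ContDiff ℝ ∞ fun r => ∫ t in a..b, f r t := by
  refine contDiff_infty.2 fun n => ?_
  induction n generalizing f with
  | zero =>
    exact contDiff_zero.2 (continuous_iff_continuousAt.2 fun r =>
      (hasDerivAt_intervalIntegral (hf.of_le (by simp)) a b r).continuousAt)
  | succ n ih =>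
    have hderiv := hasDerivAt_intervalIntegral (hf.of_le (by simp)) a b
    rw [Nat.cast_succ, contDiff_succ_iff_deriv, funext fun r => (hderiv r).deriv]
    exact ⟨fun r => (hderiv r).differentiableAt, by simp,
      ih (f := fun r t => fderiv ℝ (Function.uncurry f) (r, t) (1, 0))
        ((hf.fderiv_right (m := ∞) (by simp)).clm_apply contDiff_const)⟩

theorem exists_contDiff_eq_smul [CompleteSpace F] {f : ℝ → F} (hf : ContDiff ℝ ∞ f)
    (h0 : f 0 = 0) : ∃ g : ℝ → F, ContDiff ℝ ∞ g ∧ ∀ r, f r = r • g r := by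
  have hf' : ContDiff ℝ ∞ (deriv f) := (contDiff_infty_iff_deriv.1 hf).2
  refine ⟨fun r => ∫ t in (0 : ℝ)..1, deriv f (t * r),
    contDiff_intervalIntegral (f := fun r t => deriv f (t * r))
      (hf'.comp (contDiff_snd.mul contDiff_fst)) 0 1, fun r => ?_⟩
  have hderiv (t : ℝ) : HasDerivAt (fun t => f (t * r)) (r • deriv f (t * r)) t := by
    simpa only [Function.comp_def, id, one_mul] using
      (hf.differentiable (by simp) (t * r)).hasDerivAt.scomp t ((hasDerivAt_id t).mul_const r)
  have hcont : Continuous fun t => r • deriv f (t * r) :=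
    (hf'.continuous.comp (continuous_mul_const r)).const_smul r
  rw [← intervalIntegral.integral_smul, intervalIntegral.integral_eq_sub_of_hasDerivAt
    (fun t _ => hderiv t) (hcont.intervalIntegrable 0 1), one_mul, zero_mul, h0, sub_zero]

theorem exists_contDiff_eq_pow_smul_of_tendsto [CompleteSpace F] {n : ℕ} {f : ℝ → F} {l : F}
    (hf : ContDiff ℝ ∞ f) (h : Tendsto (fun r => (r ^ n)⁻¹ • f r) (𝓝[≠] 0) (𝓝 l)) :
    ∃ g : ℝ → F, ContDiff ℝ ∞ g ∧ (∀ r, f r = r ^ n • g r) ∧ g 0 = l := by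
  induction n generalizing f with
  | zero =>
    exact ⟨f, hf, by simp, tendsto_nhds_unique
      (hf.continuous.continuousAt.mono_left nhdsWithin_le_nhds) (by simpa using h)⟩
  | succ n ih =>
    have f_zero : f 0 = 0 := by
      have hpow : Tendsto (fun r : ℝ => r ^ (n + 1)) (𝓝[≠] 0) (𝓝 0) :=
        ((continuous_pow (n + 1)).tendsto' 0 0 (by simp)).mono_left nhdsWithin_le_nhds
      refine tendsto_nhds_unique (hf.continuous.continuousAt.mono_left nhdsWithin_le_nhds)
        (((zero_smul ℝ l) ▸ hpow.smul h).congr' ?_)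
      filter_upwards [self_mem_nhdsWithin] with r hr
      rw [smul_inv_smul₀ (pow_ne_zero _ hr)]
    obtain ⟨g, hg, hfg⟩ := exists_contDiff_eq_smul hf f_zero
    obtain ⟨k, hk, hgk, hkl⟩ := ih hg <| h.congr' <| by
      filter_upwards [self_mem_nhdsWithin] with r hr
      rw [hfg, pow_succ, mul_inv, mul_smul, inv_smul_smul₀ hr]
    exact ⟨k, hk, fun r => by rw [hfg, hgk, smul_smul, ← pow_succ'], hkl⟩

theorem tendsto_log_sq_nhdsNE : Tendsto (fun r : ℝ => Real.log (r ^ 2)) (𝓝[≠] 0) atBot := by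
  simp only [Real.log_pow]
  exact Real.tendsto_log_nhdsNE_zero.const_mul_atBot (by norm_num)

theorem tendsto_mul_log_sq_nhdsNE :
    Tendsto (fun r : ℝ => r * Real.log (r ^ 2)) (𝓝[≠] 0) (𝓝 0) := by
  have hcont : Continuous fun r : ℝ => 2 * (r * Real.log r) := Real.continuous_mul_log.const_mul 2
  refine ((hcont.tendsto' 0 0 (by simp)).mono_left nhdsWithin_le_nhds).congr fun r => ?_
  rw [Real.log_pow, Nat.cast_ofNat, mul_left_comm]

-- `a = b / log r²` tends to `0`, so it is divisible by `r`, and then `b = a log r²` tends to `0`.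
theorem apply_zero_of_mul_log_eq {a b : ℝ → ℝ} (ha : ContDiff ℝ ∞ a) (hb : ContinuousAt b 0)
    (h : ∀ᶠ r in 𝓝[≠] (0 : ℝ), a r * Real.log (r ^ 2) = b r) : a 0 = 0 ∧ b 0 = 0 := by
  have a_zero : a 0 = 0 := by
    have hdiv := (hb.mono_left (nhdsWithin_le_nhds (s := {0}ᶜ))).mul
      tendsto_log_sq_nhdsNE.inv_tendsto_atBot
    refine tendsto_nhds_unique (ha.continuous.continuousAt.mono_left nhdsWithin_le_nhds)
      ((mul_zero (b 0) ▸ hdiv).congr' ?_)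
    filter_upwards [h, tendsto_log_sq_nhdsNE.eventually (eventually_lt_atBot 0)] with r hr hlog
    rw [Pi.inv_apply, ← hr, mul_inv_cancel_right₀ hlog.ne]
  refine ⟨a_zero, ?_⟩
  obtain ⟨c, hc, hac⟩ := exists_contDiff_eq_smul ha a_zero
  have hmul := (hc.continuous.continuousAt.mono_left (nhdsWithin_le_nhds (s := {0}ᶜ))).mul
    tendsto_mul_log_sq_nhdsNE
  refine tendsto_nhds_unique (hb.mono_left nhdsWithin_le_nhds) ((mul_zero (c 0) ▸ hmul).congr' ?_)
  filter_upwards [h] with r hr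
  rw [← hr, hac, smul_eq_mul]
  ring

theorem vanishesToInfiniteOrder_of_mul_log_eq {a b : ℝ → ℝ} (ha : ContDiff ℝ ∞ a)
    (hb : ContDiff ℝ ∞ b) (h : ∀ᶠ r in 𝓝[≠] (0 : ℝ), a r * Real.log (r ^ 2) = b r) :
    VanishesToInfiniteOrder a ∧ VanishesToInfiniteOrder b := by
  have factor (n : ℕ) : ∃ a' b' : ℝ → ℝ, ContDiff ℝ ∞ a' ∧ ContDiff ℝ ∞ b' ∧
      (∀ r, a r = r ^ n • a' r) ∧ ∀ r, b r = r ^ n • b' r := by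
    induction n with
    | zero => exact ⟨a, b, ha, hb, by simp, by simp⟩
    | succ n ih =>
      obtain ⟨a', b', ha', hb', haa', hbb'⟩ := ih
      have h' : ∀ᶠ r in 𝓝[≠] (0 : ℝ), a' r * Real.log (r ^ 2) = b' r := by
        filter_upwards [h, self_mem_nhdsWithin] with r hr hr0
        rw [haa', hbb', smul_eq_mul, smul_eq_mul, mul_assoc] at hr
        exact mul_left_cancel₀ (pow_ne_zero n hr0) hr
      have hzero := apply_zero_of_mul_log_eq ha' hb'.continuous.continuousAt h'
      obtain ⟨a₁, ha₁, ha'a₁⟩ := exists_contDiff_eq_smul ha' hzero.1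
      obtain ⟨b₁, hb₁, hb'b₁⟩ := exists_contDiff_eq_smul hb' hzero.2
      exact ⟨a₁, b₁, ha₁, hb₁, fun r => by rw [haa', ha'a₁, smul_smul, pow_succ],
        fun r => by rw [hbb', hb'b₁, smul_smul, pow_succ]⟩
  choose a' b' ha' hb' haa' hbb' using factor
  exact ⟨vanishesToInfiniteOrder_of_eq_pow_smul fun n =>
      ⟨a' n, (ha' n).continuous.continuousAt, haa' n⟩,
    vanishesToInfiniteOrder_of_eq_pow_smul fun n =>
      ⟨b' n, (hb' n).continuous.continuousAt, hbb' n⟩⟩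

theorem iteratedDeriv_pow_mul_zero (n : ℕ) {g : ℝ → ℝ} (hg : ContDiff ℝ ∞ g) :
    iteratedDeriv n (fun r => r ^ n * g r) 0 = n.factorial * g 0 := by
  induction n generalizing g with
  | zero => simp
  | succ n ih =>
    have hderiv : deriv (fun r => r ^ (n + 1) * g r) =
        fun r => r ^ n * ((n + 1) * g r + r * deriv g r) := funext fun r => by
      rw [((hasDerivAt_pow (n + 1) r).fun_mul (hg.differentiable (by simp) r).hasDerivAt).deriv]
      push_cast
      ring
    have hsmooth : ContDiff ℝ ∞ fun r => (n + 1) * g r + r * deriv g r :=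
      (contDiff_const.mul hg).add (contDiff_id.mul (contDiff_infty_iff_deriv.1 hg).2)
    rw [iteratedDeriv_succ', hderiv, ih hsmooth, Nat.factorial_succ]
    push_cast
    ring

theorem iteratedDeriv_zero_eq_of_tendsto {n : ℕ} {f : ℝ → ℝ} {l : ℝ} (hf : ContDiff ℝ ∞ f)
    (h : Tendsto (fun r => f r / r ^ n) (𝓝[≠] 0) (𝓝 l)) :
    iteratedDeriv n f 0 = n.factorial * l := by
  obtain ⟨g, hg, hfg, rfl⟩ := exists_contDiff_eq_pow_smul_of_tendsto hf
    (h.congr fun r => by rw [div_eq_inv_mul, smul_eq_mul])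
  rw [funext hfg]
  exact iteratedDeriv_pow_mul_zero n hg

end OneVariable

/-! ### Expansions along rays -/

section Rays

variable {E : Type*} [NormedAddCommGroup E] [NormedSpace ℝ E]

theorem exists_polynomial_eq_apply_const_add_smul {n : ℕ}
    (M : ContinuousMultilinearMap ℝ (fun _ : Fin n => E) ℝ) (x y : E) :
    ∃ p : Polynomial ℝ, ∀ m : ℝ, (M fun _ => x + m • y) = p.eval m := by
  refine ⟨∑ s : Finset (Fin n), Polynomial.C (M (s.piecewise (fun _ => y) fun _ => x)) *
    Polynomial.X ^ s.card, fun m => ?_⟩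
  have expand : (M fun _ => x + m • y) =
      ∑ s : Finset (Fin n), M (s.piecewise (fun _ => m • y) fun _ => x) := by
    rw [funext fun _ => add_comm x (m • y)]
    exact M.toMultilinearMap.map_add_univ (fun _ => m • y) fun _ => x
  rw [expand, Polynomial.eval_finsetSum]
  refine Finset.sum_congr rfl fun s _ => ?_
  have hs : (s.piecewise (fun _ => m • y) fun _ => x) = s.piecewise
      (fun i => m • s.piecewise (fun _ => y) (fun _ => x) i)
      (s.piecewise (fun _ => y) fun _ => x) := by
    ext i
    by_cases hi : i ∈ s <;> simp [hi]
  rw [hs]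
  refine (M.toMultilinearMap.map_piecewise_smul (fun _ => m) _ s).trans ?_
  rw [Finset.prod_const, Polynomial.eval_mul, Polynomial.eval_C, Polynomial.eval_pow,
    Polynomial.eval_X, smul_eq_mul, mul_comm]
  rfl

theorem exists_polynomial_of_tendsto_rays {f : E → ℝ} (hf : ContDiff ℝ ∞ f) {n : ℕ} {x y : E}
    {l : ℝ → ℝ}
    (h : ∀ m : ℝ, Tendsto (fun r : ℝ => f (r • (x + m • y)) / r ^ n) (𝓝[≠] 0) (𝓝 (l m))) :
    ∃ p : Polynomial ℝ, ∀ m, l m = p.eval m := by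
  obtain ⟨p, hp⟩ := exists_polynomial_eq_apply_const_add_smul (iteratedFDeriv ℝ n f 0) x y
  refine ⟨Polynomial.C (n.factorial : ℝ)⁻¹ * p, fun m => ?_⟩
  have hray : ContDiff ℝ ∞ fun r : ℝ => f (r • (x + m • y)) :=
    hf.comp (contDiff_id.smul contDiff_const)
  have hderiv := iteratedDeriv_comp_smul_const (n := n)
    (hf.of_le (WithTop.coe_le_coe.2 le_top)) (x + m • y) 0
  rw [iteratedDeriv_zero_eq_of_tendsto hray (h m), zero_smul, hp] at hderiv
  rw [Polynomial.eval_mul, Polynomial.eval_C, ← hderiv,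
    inv_mul_cancel_left₀ (Nat.cast_ne_zero.2 n.factorial_ne_zero)]

theorem eq_zero_of_tendsto_rays {f : E → ℝ} (hf : ContDiff ℝ ∞ f) {n : ℕ} {x y : E} {l : ℝ → ℝ}
    (h : ∀ m : ℝ, Tendsto (fun r : ℝ => f (r • (x + m • y)) / r ^ n) (𝓝[≠] 0) (𝓝 (l m)))
    (hl : Tendsto l atTop (𝓝 0)) : l = 0 := by
  obtain ⟨p, hp⟩ := exists_polynomial_of_tendsto_rays hf h
  have hp_zero : p = 0 := Polynomial.leadingCoeff_eq_zero.1
    ((p.tendsto_nhds_iff).1 (hl.congr hp)).1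
  ext m
  rw [hp, hp_zero, Polynomial.eval_zero, Pi.zero_apply]

theorem vanishesToInfiniteOrder_of_slopes {f : R2 → ℝ} (hf : ContDiff ℝ ∞ f)
    (h : ∀ m : ℝ, VanishesToInfiniteOrder fun r : ℝ => f (r • ![1, m])) :
    VanishesToInfiniteOrder f := by
  have hdense : Dense {c : R2 | c 0 ≠ 0} :=
    (dense_compl_singleton (0 : ℝ)).preimage (isOpenMap_eval 0)
  refine vanishesToInfiniteOrder_of_rays hf hdense fun c hc => ?_
  have hscale : c = c 0 • ![1, c 1 / c 0] := by
    ext j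
    fin_cases j
    · simp
    · simp [mul_div_cancel₀ _ hc]
  have hcomp := (h (c 1 / c 0)).comp_continuousLinearMap
    (ContinuousLinearMap.toSpanSingleton ℝ (c 0))
  refine hcomp.congr (Eventually.of_forall fun r => ?_)
  simp only [ContinuousLinearMap.toSpanSingleton_apply, smul_eq_mul, mul_smul, ← hscale]

theorem VanishesToInfiniteOrder.sub_update {ι F : Type*} [Fintype ι] [DecidableEq ι]
    [NormedAddCommGroup F] [NormedSpace ℝ F] {f : (ι → ℝ) → F} (hf : Differentiable ℝ f) (i : ι)
    (h : VanishesToInfiniteOrder fun c => fderiv ℝ f c (Pi.single i 1)) :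
    VanishesToInfiniteOrder fun c => f c - f (Function.update c i 0) := fun n => by
  obtain ⟨K, hK, hbound⟩ := (h n).exists_pos
  obtain ⟨ε, hε, hball⟩ := Metric.eventually_nhds_iff_ball.1 hbound.bound
  refine Asymptotics.IsBigO.of_bound K ?_
  filter_upwards [Metric.ball_mem_nhds 0 hε, Metric.ball_mem_nhds 0 one_pos] with c hc hc1
  have norm_update {s : ℝ} (hs : ‖s‖ ≤ ‖c i‖) : ‖Function.update c i s‖ ≤ ‖c‖ := by
    refine (pi_norm_le_iff_of_nonneg (norm_nonneg c)).2 fun j => ?_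
    rcases eq_or_ne j i with rfl | hj
    · simpa using hs.trans (norm_le_pi_norm c j)
    · simpa [hj] using norm_le_pi_norm c j
  have hmean := (convex_closedBall (0 : ℝ) ‖c i‖).norm_image_sub_le_of_norm_hasDerivWithin_le
    (f := fun s => f (Function.update c i s)) (C := K * ‖c‖ ^ n) (x := 0) (y := c i)
    (fun s _ => ((hf _).hasFDerivAt.comp_hasDerivAt s (hasDerivAt_update c i s)).hasDerivWithinAt)
    (fun s hs => by
      have hs' := norm_update (mem_closedBall_zero_iff.1 hs)
      refine (hball _ (mem_ball_zero_iff.2 (hs'.trans_lt (mem_ball_zero_iff.1 hc)))).trans ?_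
      rw [norm_pow, norm_norm]
      gcongr)
    (Metric.mem_closedBall_self (norm_nonneg _)) (mem_closedBall_zero_iff.2 le_rfl)
  rw [Function.update_eq_self, sub_zero] at hmean
  calc
    ‖f c - f (Function.update c i 0)‖ ≤ K * ‖c‖ ^ n * ‖c i‖ := hmean
    _ ≤ K * ‖c‖ ^ n * 1 := by
      gcongr
      exact (norm_le_pi_norm c i).trans (mem_ball_zero_iff.1 hc1).le
    _ = K * ‖‖c‖ ^ n‖ := by rw [norm_pow, norm_norm, mul_one]

end Rays

/-! ### The logarithmic relation -/

section LogRelation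

/-- The increment `log (1 + (m + x)²) - log (1 + m²)`, which measures how `log (a² + b²)` changes
along a ray when its slope `m` is replaced by `m + x`. -/
noncomputable def logShift (m x : ℝ) : ℝ := Real.log (1 + (m + x) ^ 2) - Real.log (1 + m ^ 2)

theorem continuous_logShift (m : ℝ) : Continuous (logShift m) :=
  ((by fun_prop : Continuous fun x : ℝ => 1 + (m + x) ^ 2).log fun x => by positivity).sub
    continuous_const

theorem hasDerivAt_logShift_zero (m : ℝ) : HasDerivAt (logShift m) (2 * m / (1 + m ^ 2)) 0 := by
  have hlog := ((((hasDerivAt_id (0 : ℝ)).const_add m).fun_pow 2).const_add 1).log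
    (by simp only [id]; positivity)
  exact (hlog.sub_const (Real.log (1 + m ^ 2))).congr_deriv (by simp)

theorem tendsto_two_mul_div_one_add_sq :
    Tendsto (fun m : ℝ => 2 * m / (1 + m ^ 2)) atTop (𝓝 0) := by
  have hinv : Tendsto (fun m : ℝ => 2 * m⁻¹) atTop (𝓝 0) := by
    simpa using tendsto_inv_atTop_zero.const_mul (2 : ℝ)
  refine squeeze_zero' ?_ ?_ hinv
  · filter_upwards [eventually_ge_atTop 0] with m hm
    positivity
  · filter_upwards [eventually_gt_atTop 0] with m hm
    rw [div_le_iff₀ (by positivity)]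
    have : 2 * m⁻¹ * (1 + m ^ 2) = 2 * m⁻¹ + 2 * m := by field_simp
    linarith [inv_pos.2 hm]

theorem tendsto_logShift_div_pow_succ {n : ℕ} {x : ℝ → ℝ} {w : ℝ}
    (hx : Tendsto (fun r => x r / r ^ (n + 1)) (𝓝[≠] 0) (𝓝 w)) (m : ℝ) :
    Tendsto (fun r => logShift m (x r) / r ^ (n + 1)) (𝓝[≠] 0) (𝓝 (w * (2 * m / (1 + m ^ 2)))) := by
  have hne : ∀ᶠ r : ℝ in 𝓝[≠] 0, r ^ (n + 1) ≠ 0 := by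
    filter_upwards [self_mem_nhdsWithin] with r hr using pow_ne_zero _ hr
  have hx_isBigO : x =O[𝓝[≠] 0] fun r => r ^ (n + 1) :=
    Asymptotics.isBigO_of_div_tendsto_nhds (hne.mono fun r hr h0 => absurd h0 hr) w hx
  have hx_zero : Tendsto x (𝓝[≠] 0) (𝓝 0) := by
    have hpow : Tendsto (fun r : ℝ => r ^ (n + 1)) (𝓝[≠] 0) (𝓝 0) :=
      ((continuous_pow (n + 1)).tendsto' 0 0 (by simp)).mono_left nhdsWithin_le_nhds
    exact hx_isBigO.trans_tendsto hpow
  have hlittle := ((hasDerivAt_logShift_zero m).isLittleO.comp_tendsto hx_zero).trans_isBigO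
    (by simpa [Function.comp_def] using hx_isBigO)
  have hsum := hlittle.tendsto_div_nhds_zero.add (hx.mul_const (2 * m / (1 + m ^ 2)))
  rw [zero_add] at hsum
  refine hsum.congr fun r => ?_
  simp only [logShift, add_zero, sub_self, sub_zero, smul_eq_mul, Function.comp_apply]
  ring

-- For `n = 0` the function `m ↦ logShift m w` is constant; for `n > 0` the order-`n` part of `S`
-- is the polynomial `w * 2 m / (1 + m²)` in the slope `m`. Either forces `w = 0`.
theorem eq_zero_of_sub_logShift_isLittleO {S : R2 → ℝ} (hS : ContDiff ℝ ∞ S) {n : ℕ} {w : ℝ}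
    {x : ℝ → ℝ → ℝ} (hx : ∀ m, Tendsto (fun r => x m r / r ^ n) (𝓝[≠] 0) (𝓝 w))
    (h : ∀ m, (fun r => S (r • ![1, m]) - logShift m (x m r)) =o[𝓝[≠] 0] fun r => r ^ n) :
    w = 0 := by
  cases n with
  | zero =>
    have shift_eq (m : ℝ) : logShift m w = S 0 := by
      have hray : Tendsto (fun r : ℝ => S (r • ![1, m])) (𝓝[≠] 0) (𝓝 (S 0)) :=
        (hS.continuous.comp (continuous_id.smul continuous_const)).tendsto' 0 (S 0) (by simp)
          |>.mono_left nhdsWithin_le_nhds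
      have hshift := (continuous_logShift m).continuousAt.tendsto.comp
        (by simpa using hx m : Tendsto (x m) (𝓝[≠] 0) (𝓝 w))
      have hsub : Tendsto (fun r => S (r • ![1, m]) - logShift m (x m r)) (𝓝[≠] 0) (𝓝 0) := by
        simpa using (h m).tendsto_div_nhds_zero
      exact (sub_eq_zero.1 (tendsto_nhds_unique (hray.sub hshift) hsub)).symm
    have shift_neg_half : logShift (-w / 2) w = 0 := by
      rw [logShift, sub_eq_zero]
      ring_nf
    have hlog : Real.log (1 + w ^ 2) = 0 := by
      simpa [logShift] using (shift_eq 0).trans ((shift_eq (-w / 2)).symm.trans shift_neg_half)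
    by_contra hw
    exact (Real.log_pos (by simpa using pow_pos (abs_pos.2 hw) 2)).ne' hlog
  | succ n =>
    have hray (m : ℝ) : Tendsto (fun r : ℝ => S (r • (![1, 0] + m • ![0, 1])) / r ^ (n + 1))
        (𝓝[≠] 0) (𝓝 (w * (2 * m / (1 + m ^ 2)))) := by
      have hsum := (h m).tendsto_div_nhds_zero.add (tendsto_logShift_div_pow_succ (hx m) m)
      simpa [← add_div] using hsum
    have decay : Tendsto (fun m : ℝ => w * (2 * m / (1 + m ^ 2))) atTop (𝓝 0) := by
      simpa using tendsto_two_mul_div_one_add_sq.const_mul w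
    simpa using congrFun (eq_zero_of_tendsto_rays hS hray decay) 1

/-- The relation `∂_b u · log (a² + u²) = log (a² + b²) + S` near the origin, off the axis `a = 0`.
It compares the times that the flow of `q₂` needs to pass the singular point before and after a
lift of `(a, b) ↦ (a, u)`. -/
def LogRelation (u S : R2 → ℝ) : Prop :=
  ∀ᶠ c in 𝓝 (0 : R2), c 0 ≠ 0 → fderiv ℝ u c ![0, 1] * Real.log (c 0 ^ 2 + u c ^ 2) =
    Real.log (c 0 ^ 2 + c 1 ^ 2) + S c

namespace LogRelation

variable {u S : R2 → ℝ}

theorem log_sq_add_mul_sq {r : ℝ} (hr : r ≠ 0) (m : ℝ) :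
    Real.log (r ^ 2 + (r * m) ^ 2) = Real.log (r ^ 2) + Real.log (1 + m ^ 2) := by
  rw [← Real.log_mul (by positivity) (by positivity)]
  congr 1
  ring

theorem vanishesToInfiniteOrder_of_slope (h : LogRelation u S) (hu : ContDiff ℝ ∞ u)
    (hS : ContDiff ℝ ∞ S) {m : ℝ} {V : ℝ → ℝ} (hV : ContDiff ℝ ∞ V)
    (huV : ∀ r, u (r • ![1, m]) = r * V r) :
    (VanishesToInfiniteOrder fun r : ℝ => fderiv ℝ u (r • ![1, m]) ![0, 1] - 1) ∧
      VanishesToInfiniteOrder fun r : ℝ => S (r • ![1, m]) - logShift m (V r - m) := by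
  have hray : ContDiff ℝ ∞ fun r : ℝ => r • (![1, m] : R2) := contDiff_id.smul contDiff_const
  have hderiv : ContDiff ℝ ∞ fun r : ℝ => fderiv ℝ u (r • ![1, m]) ![0, 1] :=
    ((hu.fderiv_right (m := ∞) (by simp)).clm_apply contDiff_const).comp hray
  have hlog : ContDiff ℝ ∞ fun r => Real.log (1 + V r ^ 2) :=
    (contDiff_const.add (hV.pow 2)).log fun r => by positivity
  obtain ⟨deriv_sub_one, remainder⟩ := vanishesToInfiniteOrder_of_mul_log_eq
    (hderiv.sub (contDiff_const (c := (1 : ℝ))))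
    (b := fun r => Real.log (1 + m ^ 2) + S (r • ![1, m]) -
      fderiv ℝ u (r • ![1, m]) ![0, 1] * Real.log (1 + V r ^ 2))
    ((contDiff_const.add (hS.comp hray)).sub (hderiv.mul hlog)) <| by
      have htends : Tendsto (fun r : ℝ => r • (![1, m] : R2)) (𝓝[≠] 0) (𝓝 0) :=
        (hray.continuous.tendsto' 0 0 (zero_smul ℝ _)).mono_left nhdsWithin_le_nhds
      filter_upwards [htends.eventually h, self_mem_nhdsWithin] with r hr hr0
      have hrel := hr (by simpa using hr0)
      simp only [huV, Pi.smul_apply, Matrix.cons_val_zero, Matrix.cons_val_one, smul_eq_mul,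
        mul_one, log_sq_add_mul_sq hr0] at hrel
      linear_combination hrel
  refine ⟨deriv_sub_one, (remainder.add
    (deriv_sub_one.mul_of_continuousAt hlog.continuous.continuousAt)).congr
    (Eventually.of_forall fun r => ?_)⟩
  simp only [logShift, add_sub_cancel]
  ring

theorem vanishesToInfiniteOrder_sub_axis (h : LogRelation u S) (hu : ContDiff ℝ ∞ u)
    (hS : ContDiff ℝ ∞ S) (hu0 : u 0 = 0) :
    VanishesToInfiniteOrder fun c => u c - c 1 - u (Function.update c 1 0) := by
  have hfst : ContDiff ℝ ∞ fun c => fderiv ℝ u c ![0, 1] - 1 :=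
    ((hu.fderiv_right (m := ∞) (by simp)).clm_apply contDiff_const).sub contDiff_const
  have deriv_sub_one : VanishesToInfiniteOrder fun c => fderiv ℝ u c ![0, 1] - 1 := by
    refine vanishesToInfiniteOrder_of_slopes hfst fun m => ?_
    obtain ⟨V, hV, huV⟩ := exists_contDiff_eq_smul (f := fun r : ℝ => u (r • ![1, m]))
      (hu.comp (contDiff_id.smul contDiff_const)) (by simp [hu0])
    exact (h.vanishesToInfiniteOrder_of_slope hu hS hV huV).1
  have hdiff : ContDiff ℝ ∞ fun c : R2 => u c - c 1 := hu.sub (contDiff_apply ℝ ℝ 1)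
  have hsub := VanishesToInfiniteOrder.sub_update (hdiff.differentiable (by simp)) 1 <|
    deriv_sub_one.congr <| Eventually.of_forall fun c => by
      have hsingle : (![0, 1] : R2) = Pi.single 1 1 := by ext i; fin_cases i <;> rfl
      have hderiv : HasFDerivAt (fun c : R2 => u c - c 1)
          (fderiv ℝ u c - ContinuousLinearMap.proj 1) c :=
        (hu.differentiable (by simp) c).hasFDerivAt.sub (hasFDerivAt_apply 1 c)
      simp [hderiv.fderiv, hsingle]
  simpa using hsub

-- `x m r = V m r - m` and `V 0 r` have the same expansion for every slope `m`, so the leading term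
-- of `V 0 r` can be compared with the smooth function `S` by `eq_zero_of_sub_logShift_isLittleO`.
theorem vanishesToInfiniteOrder_axis (h : LogRelation u S) (hu : ContDiff ℝ ∞ u)
    (hS : ContDiff ℝ ∞ S) (hu0 : u 0 = 0) {V : ℝ → ℝ → ℝ} (hV : ∀ m, ContDiff ℝ ∞ (V m))
    (huV : ∀ m r, u (r • ![1, m]) = r * V m r) : VanishesToInfiniteOrder (V 0) := by
  have sub_zero_slope (m : ℝ) : VanishesToInfiniteOrder fun r => r * (V m r - m - V 0 r) := by
    refine ((h.vanishesToInfiniteOrder_sub_axis hu hS hu0).comp_continuousLinearMap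
      (ContinuousLinearMap.toSpanSingleton ℝ (![1, m] : R2))).congr
      (Eventually.of_forall fun r => ?_)
    have haxis : Function.update (r • (![1, m] : R2)) 1 0 = r • ![1, 0] := by
      ext i
      fin_cases i <;> simp
    simp only [ContinuousLinearMap.toSpanSingleton_apply, haxis, huV, Pi.smul_apply,
      Matrix.cons_val_one, Matrix.cons_val_fin_one, smul_eq_mul]
    ring
  refine vanishesToInfiniteOrder_of_eq_pow_smul fun n => ?_
  suffices ∃ g : ℝ → ℝ, ContDiff ℝ ∞ g ∧ ∀ r, V 0 r = r ^ n • g r from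
    this.imp fun g hg => ⟨hg.1.continuous.continuousAt, hg.2⟩
  induction n with
  | zero => exact ⟨V 0, hV 0, by simp⟩
  | succ n ih =>
    obtain ⟨g, hg, hVg⟩ := ih
    have hslope (m : ℝ) : Tendsto (fun r => (V m r - m) / r ^ n) (𝓝[≠] 0) (𝓝 (g 0)) := by
      have hdiv := ((sub_zero_slope m).tendsto_div_pow (n + 1)).add
        (hg.continuous.continuousAt.mono_left nhdsWithin_le_nhds)
      refine (zero_add (g 0) ▸ hdiv).congr' ?_
      filter_upwards [self_mem_nhdsWithin] with r (hr : r ≠ 0)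
      rw [hVg, smul_eq_mul]
      field_simp
      ring
    have g_zero : g 0 = 0 := eq_zero_of_sub_logShift_isLittleO hS hslope fun m =>
      (h.vanishesToInfiniteOrder_of_slope hu hS (hV m) (huV m)).2.isLittleO_pow n
        |>.mono nhdsWithin_le_nhds
    obtain ⟨g', hg', hgg'⟩ := exists_contDiff_eq_smul hg g_zero
    exact ⟨g', hg', fun r => by rw [hVg, hgg', smul_smul, pow_succ]⟩

theorem vanishesToInfiniteOrder_sub (h : LogRelation u S) (hu : ContDiff ℝ ∞ u)
    (hS : ContDiff ℝ ∞ S) (hu0 : u 0 = 0) : VanishesToInfiniteOrder fun c => u c - c 1 := by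
  have factor (m : ℝ) := exists_contDiff_eq_smul (f := fun r : ℝ => u (r • ![1, m]))
    (hu.comp (contDiff_id.smul contDiff_const)) (by simp [hu0])
  choose V hV huV using factor
  have axis := (h.vanishesToInfiniteOrder_axis hu hS hu0 hV huV).comp_continuousLinearMap
    (ContinuousLinearMap.proj 0 : R2 →L[ℝ] ℝ)
  refine ((h.vanishesToInfiniteOrder_sub_axis hu hS hu0).add
    (axis.mul_of_continuousAt (continuous_apply 0).continuousAt)).congr
    (Eventually.of_forall fun c => ?_)
  have haxis : Function.update c 1 0 = c 0 • (![1, 0] : R2) := by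
    ext i
    fin_cases i <;> simp
  simp only [haxis, huV, ContinuousLinearMap.proj_apply, smul_eq_mul]
  ring

end LogRelation

end LogRelation

/-! ### Complex coordinates and the joint flow -/

section ComplexCoordinates

/-- The complex coordinate `x₁ + i x₂`. -/
noncomputable def zCoord : R4 →L[ℝ] ℂ :=
  (Complex.equivRealProdCLM.symm : ℝ × ℝ →L[ℝ] ℂ) ∘L
    (ContinuousLinearMap.proj (0 : Fin 4)).prod (ContinuousLinearMap.proj (2 : Fin 4))

/-- The complex coordinate `y₁ + i y₂`. -/
noncomputable def wCoord : R4 →L[ℝ] ℂ :=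
  (Complex.equivRealProdCLM.symm : ℝ × ℝ →L[ℝ] ℂ) ∘L
    (ContinuousLinearMap.proj (1 : Fin 4)).prod (ContinuousLinearMap.proj (3 : Fin 4))

/-- The point of `ℝ⁴` with given complex coordinates. -/
def ofComplex (z w : ℂ) : R4 := ![z.re, w.re, z.im, w.im]

/-- The identification of `ℝ²` with `ℂ` by `(a, b) ↦ b + i a`; in this order `q` becomes
`(z, w) ↦ conj z * w`. -/
noncomputable def toComplex : R2 →L[ℝ] ℂ :=
  (Complex.equivRealProdCLM.symm : ℝ × ℝ →L[ℝ] ℂ) ∘L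
    (ContinuousLinearMap.proj (1 : Fin 2)).prod (ContinuousLinearMap.proj (0 : Fin 2))

theorem zCoord_apply (x : R4) : zCoord x = ⟨x 0, x 2⟩ := rfl

theorem wCoord_apply (x : R4) : wCoord x = ⟨x 1, x 3⟩ := rfl

theorem toComplex_apply (c : R2) : toComplex c = ⟨c 1, c 0⟩ := rfl

@[simp]
theorem zCoord_ofComplex (z w : ℂ) : zCoord (ofComplex z w) = z := rfl

@[simp]
theorem wCoord_ofComplex (z w : ℂ) : wCoord (ofComplex z w) = w := rfl

theorem ofComplex_zCoord_wCoord (x : R4) : ofComplex (zCoord x) (wCoord x) = x := by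
  ext i
  fin_cases i <;> rfl

theorem eq_of_zCoord_eq_of_wCoord_eq {x y : R4} (hz : zCoord x = zCoord y)
    (hw : wCoord x = wCoord y) : x = y := by
  rw [← ofComplex_zCoord_wCoord x, hz, hw, ofComplex_zCoord_wCoord]

theorem norm_le_max_zCoord_wCoord (x : R4) : ‖x‖ ≤ max ‖zCoord x‖ ‖wCoord x‖ := by
  refine (pi_norm_le_iff_of_nonneg (by positivity)).2 fun i => ?_
  fin_cases i
  · exact (Complex.abs_re_le_norm (zCoord x)).trans (le_max_left _ _)
  · exact (Complex.abs_re_le_norm (wCoord x)).trans (le_max_right _ _)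
  · exact (Complex.abs_im_le_norm (zCoord x)).trans (le_max_left _ _)
  · exact (Complex.abs_im_le_norm (wCoord x)).trans (le_max_right _ _)

theorem toComplex_injective : Function.Injective toComplex := by
  intro c c' h
  ext i
  fin_cases i
  · exact congrArg Complex.im h
  · exact congrArg Complex.re h

theorem normSq_toComplex (c : R2) : Complex.normSq (toComplex c) = c 0 ^ 2 + c 1 ^ 2 := by
  rw [toComplex_apply, Complex.normSq_mk]
  ring

theorem toComplex_ne_zero {c : R2} (hc : c ≠ 0) : toComplex c ≠ 0 :=
  (map_ne_zero_iff toComplex toComplex_injective).2 hc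

theorem toComplex_q (x : R4) : toComplex (q x) = starRingEnd ℂ (zCoord x) * wCoord x := by
  apply Complex.ext
  · simp [toComplex_apply, zCoord_apply, wCoord_apply, q]
  · simp only [q, toComplex_apply, zCoord_apply, wCoord_apply, Complex.mul_im, Complex.conj_re,
      Complex.conj_im, Matrix.cons_val]
    ring

theorem q_eq_iff {x : R4} {c : R2} :
    q x = c ↔ starRingEnd ℂ (zCoord x) * wCoord x = toComplex c := by
  rw [← toComplex_q, toComplex_injective.eq_iff]

theorem normSq_zCoord_mul_normSq_wCoord (x : R4) :
    Complex.normSq (zCoord x) * Complex.normSq (wCoord x) = q x 0 ^ 2 + q x 1 ^ 2 := by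
  rw [← normSq_toComplex, toComplex_q, Complex.normSq_mul, Complex.normSq_conj]

theorem contDiff_q : ContDiff ℝ ∞ q := by
  refine contDiff_pi.2 fun i => ?_
  fin_cases i
  · change ContDiff ℝ ∞ fun x : R4 => x 0 * x 3 - x 2 * x 1
    fun_prop
  · change ContDiff ℝ ∞ fun x : R4 => x 0 * x 1 + x 2 * x 3
    fun_prop

theorem contDiff_normSq_comp {E : Type*} [NormedAddCommGroup E] [NormedSpace ℝ E] (L : E →L[ℝ] ℂ) :
    ContDiff ℝ ∞ fun x => Complex.normSq (L x) := by
  simp only [Complex.normSq_eq_norm_sq]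
  exact L.contDiff.norm_sq ℝ

end ComplexCoordinates

section Symplectic

theorem eq_of_omegaCan_eq {u u' : R4} (h : ∀ v, omegaCan u v = omegaCan u' v) : u = u' := by
  have h0 := h ![0, 1, 0, 0]
  have h1 := h ![-1, 0, 0, 0]
  have h2 := h ![0, 0, 0, 1]
  have h3 := h ![0, 0, -1, 0]
  simp only [omegaCan, Matrix.cons_val] at h0 h1 h2 h3
  ext i
  fin_cases i <;> simp only [Fin.zero_eta, Fin.mk_one, Fin.reduceFinMk] <;> linarith

theorem surjective_of_omegaCan_eq {L : R4 →L[ℝ] R4}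
    (h : ∀ u v, omegaCan (L u) (L v) = omegaCan u v) : Function.Surjective L := by
  refine (LinearMap.injective_iff_surjective (f := (L : R4 →ₗ[ℝ] R4))).1 fun u u' huu' => ?_
  refine eq_of_omegaCan_eq fun v => ?_
  rw [← h u, ← h u']
  exact congrArg (omegaCan · (L v)) huu'

/-- The value at `v` of the covector with coordinates `(a, b)`, where `ζ = b + i a`. -/
def pairing (ζ : ℂ) (v : R2) : ℝ := ζ.im * v 0 + ζ.re * v 1

/-- The Hamiltonian vector field of the function `a q₁ + b q₂`, where `ζ = b + i a`. -/
noncomputable def hamField (ζ : ℂ) (x : R4) : R4 :=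
  ofComplex (ζ * zCoord x) (-starRingEnd ℂ ζ * wCoord x)

theorem fderiv_q_apply (x v : R4) :
    fderiv ℝ q x v = ![x 0 * v 3 + x 3 * v 0 - (x 2 * v 1 + x 1 * v 2),
      x 0 * v 1 + x 1 * v 0 + (x 2 * v 3 + x 3 * v 2)] := by
  have hcoord (i : Fin 4) := hasFDerivAt_apply (𝕜 := ℝ) i x
  have hq := hasFDerivAt_pi'.1 (contDiff_q.differentiable (by simp) x).hasFDerivAt
  have h0 := (hq 0).unique (((hcoord 0).mul (hcoord 3)).sub ((hcoord 2).mul (hcoord 1)))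
  have h1 := (hq 1).unique (((hcoord 0).mul (hcoord 1)).add ((hcoord 2).mul (hcoord 3)))
  ext i
  fin_cases i
  · exact congrArg (fun L => L v) h0
  · exact congrArg (fun L => L v) h1

theorem omegaCan_hamField (ζ : ℂ) (x v : R4) :
    omegaCan (hamField ζ x) v = pairing ζ (fderiv ℝ q x v) := by
  rw [fderiv_q_apply]
  simp only [omegaCan, hamField, ofComplex, zCoord_apply, Complex.mul_re, wCoord_apply,
    Complex.neg_re, Complex.conj_re, Complex.conj_im, Complex.mul_im, Complex.neg_im, pairing,
    Matrix.cons_val]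
  ring

theorem clm_apply_eq_smul_add_smul {F : Type*} [AddCommGroup F] [Module ℝ F] [TopologicalSpace F]
    (K : R2 →L[ℝ] F) (v : R2) : K v = v 0 • K ![1, 0] + v 1 • K ![0, 1] := by
  rw [← map_smul, ← map_smul, ← map_add]
  congr 1
  ext i
  fin_cases i <;> simp

/-- The transpose of `K` with respect to `pairing`. -/
def pullback (K : R2 →L[ℝ] R2) (ζ : ℂ) : ℂ :=
  ⟨pairing ζ (K ![0, 1]), pairing ζ (K ![1, 0])⟩

theorem pairing_pullback (K : R2 →L[ℝ] R2) (ζ : ℂ) (v : R2) :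
    pairing (pullback K ζ) v = pairing ζ (K v) := by
  rw [clm_apply_eq_smul_add_smul K v]
  simp only [pairing, pullback, Pi.add_apply, Pi.smul_apply, smul_eq_mul]
  ring

/-- The conditions at the point `x` on a symplectic map `f` with `q ∘ f = g ∘ q`, where `k` is the
inverse of `g`. -/
structure IsLocalLiftAt (f : R4 → R4) (g k : R2 → R2) (x : R4) : Prop where
  differentiableAt : DifferentiableAt ℝ f x
  symplectic : ∀ u v, omegaCan (fderiv ℝ f x u) (fderiv ℝ f x v) = omegaCan u v
  lift : q (f x) = g (q x)
  inv_differentiableAt : DifferentiableAt ℝ k (g (q x))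
  inv_lift : ∀ᶠ y in 𝓝 x, k (q (f y)) = q y

theorem IsLocalLiftAt.fderiv_hamField {f : R4 → R4} {g k : R2 → R2} {x : R4}
    (h : IsLocalLiftAt f g k x) (ζ : ℂ) :
    fderiv ℝ f x (hamField ζ x) = hamField (pullback (fderiv ℝ k (g (q x))) ζ) (f x) := by
  refine eq_of_omegaCan_eq fun w => ?_
  obtain ⟨v, rfl⟩ := surjective_of_omegaCan_eq h.symplectic w
  have hchain : fderiv ℝ q x =
      (fderiv ℝ k (g (q x))).comp ((fderiv ℝ q (f x)).comp (fderiv ℝ f x)) := by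
    have hq : HasFDerivAt q (fderiv ℝ q (f x)) (f x) :=
      (contDiff_q.differentiable (by simp) _).hasFDerivAt
    have hk := h.inv_differentiableAt.hasFDerivAt
    rw [← h.lift] at hk ⊢
    rw [← EventuallyEq.fderiv_eq h.inv_lift]
    exact (hk.comp x (hq.comp x h.differentiableAt.hasFDerivAt)).fderiv
  rw [h.symplectic, omegaCan_hamField, omegaCan_hamField, pairing_pullback, hchain]
  rfl

end Symplectic

section Flow

/-- The time-one flow of `hamField ζ`. -/
noncomputable def flow (ζ : ℂ) (x : R4) : R4 :=
  ofComplex (Complex.exp ζ * zCoord x) (Complex.exp (-starRingEnd ℂ ζ) * wCoord x)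

@[simp]
theorem zCoord_flow (ζ : ℂ) (x : R4) : zCoord (flow ζ x) = Complex.exp ζ * zCoord x := rfl

@[simp]
theorem wCoord_flow (ζ : ℂ) (x : R4) :
    wCoord (flow ζ x) = Complex.exp (-starRingEnd ℂ ζ) * wCoord x := rfl

@[simp]
theorem flow_zero (x : R4) : flow 0 x = x := by
  apply eq_of_zCoord_eq_of_wCoord_eq <;> simp

theorem flow_two_pi_mul_I (x : R4) : flow (2 * Real.pi * Complex.I) x = x := by
  have hconj : -starRingEnd ℂ (2 * Real.pi * Complex.I) = 2 * Real.pi * Complex.I := by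
    apply Complex.ext <;> simp
  apply eq_of_zCoord_eq_of_wCoord_eq
  · rw [zCoord_flow, Complex.exp_two_pi_mul_I, one_mul]
  · rw [wCoord_flow, hconj, Complex.exp_two_pi_mul_I, one_mul]

theorem q_flow (ζ : ℂ) (x : R4) : q (flow ζ x) = q x := by
  rw [q_eq_iff, toComplex_q, zCoord_flow, wCoord_flow, map_mul, ← Complex.exp_conj,
    mul_mul_mul_comm, ← Complex.exp_add, add_neg_cancel, Complex.exp_zero, one_mul]

theorem normSq_zCoord_flow (ζ : ℂ) (x : R4) :
    Complex.normSq (zCoord (flow ζ x)) = Real.exp (2 * ζ.re) * Complex.normSq (zCoord x) := by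
  rw [zCoord_flow, Complex.normSq_mul, Complex.normSq_eq_norm_sq, Complex.norm_exp,
    ← Real.exp_nat_mul, Nat.cast_ofNat]

theorem normSq_wCoord_flow (ζ : ℂ) (x : R4) :
    Complex.normSq (wCoord (flow ζ x)) = Real.exp (-(2 * ζ.re)) * Complex.normSq (wCoord x) := by
  rw [wCoord_flow, Complex.normSq_mul, Complex.normSq_eq_norm_sq, Complex.norm_exp,
    ← Real.exp_nat_mul, Complex.neg_re, Complex.conj_re, Nat.cast_ofNat, mul_neg]

theorem hasDerivAt_cexp_mul (ζ z : ℂ) (t : ℝ) :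
    HasDerivAt (fun t : ℝ => Complex.exp (t * ζ) * z) (ζ * (Complex.exp (t * ζ) * z)) t := by
  have h : HasDerivAt (fun t : ℝ => (t : ℂ) * ζ) ζ t := by
    simpa only [one_mul, Complex.ofReal_one, id] using
      (HasDerivAt.ofReal_comp (hasDerivAt_id t)).mul_const ζ
  refine (h.cexp.mul_const z).congr_deriv ?_
  ring

theorem hasDerivAt_ofComplex {z w : ℝ → ℂ} {z' w' : ℂ} {t : ℝ} (hz : HasDerivAt z z' t)
    (hw : HasDerivAt w w' t) :
    HasDerivAt (fun t => ofComplex (z t) (w t)) (ofComplex z' w') t := by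
  refine hasDerivAt_pi.2 fun i => ?_
  fin_cases i
  · exact Complex.reCLM.hasFDerivAt.comp_hasDerivAt t hz
  · exact Complex.reCLM.hasFDerivAt.comp_hasDerivAt t hw
  · exact Complex.imCLM.hasFDerivAt.comp_hasDerivAt t hz
  · exact Complex.imCLM.hasFDerivAt.comp_hasDerivAt t hw

theorem hasDerivAt_flow (ζ : ℂ) (x : R4) (t : ℝ) :
    HasDerivAt (fun t : ℝ => flow (t * ζ) x) (hamField ζ (flow (t * ζ) x)) t := by
  have hconj (t : ℝ) : -starRingEnd ℂ (t * ζ) = t * -starRingEnd ℂ ζ := by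
    rw [map_mul, Complex.conj_ofReal, mul_neg]
  simp only [flow, hamField, zCoord_ofComplex, wCoord_ofComplex, hconj]
  exact hasDerivAt_ofComplex (hasDerivAt_cexp_mul _ _ _) (hasDerivAt_cexp_mul _ _ _)

theorem eq_exp_mul_of_hasDerivAt {f : ℝ → ℂ} {ζ : ℂ}
    (h : ∀ t ∈ Set.Icc (0 : ℝ) 1, HasDerivAt f (ζ * f t) t) : f 1 = Complex.exp ζ * f 0 := by
  have hd : ∀ t ∈ Set.Icc (0 : ℝ) 1,
      HasDerivAt (fun t : ℝ => Complex.exp (t * -ζ) * 1 * f t) 0 t := fun t ht =>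
    ((hasDerivAt_cexp_mul (-ζ) 1 t).mul (h t ht)).congr_deriv (by ring)
  have hconst := constant_of_has_deriv_right_zero
    (fun t ht => (hd t ht).continuousAt.continuousWithinAt)
    (fun t ht => (hd t ⟨ht.1, ht.2.le⟩).hasDerivWithinAt) 1 (by simp)
  simp only [Complex.ofReal_one, one_mul, mul_one, Complex.ofReal_zero, zero_mul,
    Complex.exp_zero] at hconst
  rw [← hconst, ← mul_assoc, ← Complex.exp_add, add_neg_cancel, Complex.exp_zero, one_mul]

theorem eq_flow_of_hasDerivAt {γ : ℝ → R4} {ζ : ℂ}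
    (h : ∀ t ∈ Set.Icc (0 : ℝ) 1, HasDerivAt γ (hamField ζ (γ t)) t) :
    γ 1 = flow ζ (γ 0) :=
  eq_of_zCoord_eq_of_wCoord_eq
    (eq_exp_mul_of_hasDerivAt (f := fun t => zCoord (γ t)) fun t ht =>
      zCoord.hasFDerivAt.comp_hasDerivAt t (h t ht))
    (eq_exp_mul_of_hasDerivAt (f := fun t => wCoord (γ t)) fun t ht =>
      wCoord.hasFDerivAt.comp_hasDerivAt t (h t ht))

theorem map_flow_of_isLocalLiftAt {f : R4 → R4} {g k : R2 → R2} {x : R4} {ζ : ℂ}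
    (h : ∀ t ∈ Set.Icc (0 : ℝ) 1, IsLocalLiftAt f g k (flow (t * ζ) x)) :
    f (flow ζ x) = flow (pullback (fderiv ℝ k (g (q x))) ζ) (f x) := by
  have hγ := eq_flow_of_hasDerivAt (γ := fun t : ℝ => f (flow (t * ζ) x)) fun t ht => by
    have hd := (h t ht).differentiableAt.hasFDerivAt.comp_hasDerivAt t (hasDerivAt_flow ζ x t)
    rwa [(h t ht).fderiv_hamField, q_flow] at hd
  simpa only [Complex.ofReal_one, one_mul, Complex.ofReal_zero, zero_mul, flow_zero] using hγ

end Flow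

/-! ### The first component -/

section Bidisc

/-- The closed bidisc of radius `δ` in the complex coordinates. -/
def bidisc (δ : ℝ) : Set R4 := {x | ‖zCoord x‖ ≤ δ ∧ ‖wCoord x‖ ≤ δ}

theorem eventually_forall_mem_bidisc {P : R4 → Prop} (h : ∀ᶠ x in 𝓝 0, P x) :
    ∀ᶠ δ in 𝓝[>] (0 : ℝ), ∀ x ∈ bidisc δ, P x := by
  obtain ⟨ε, hε, hP⟩ := Metric.eventually_nhds_iff_ball.1 h
  filter_upwards [Ioo_mem_nhdsGT hε] with δ hδ x hx
  refine hP x (mem_ball_zero_iff.2 ?_)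
  exact (norm_le_max_zCoord_wCoord x).trans_lt ((max_le hx.1 hx.2).trans_lt hδ.2)

theorem flow_mul_mem_bidisc {δ : ℝ} {ζ : ℂ} {x : R4} (hx : x ∈ bidisc δ)
    (hy : flow ζ x ∈ bidisc δ) {t : ℝ} (ht : t ∈ Set.Icc (0 : ℝ) 1) :
    flow (t * ζ) x ∈ bidisc δ := by
  have hnorm (η z : ℂ) (hz : ‖z‖ ≤ δ) (hη : ‖Complex.exp η * z‖ ≤ δ) :
      ‖Complex.exp (t * η) * z‖ ≤ δ := by
    rw [norm_mul, Complex.norm_exp] at hη ⊢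
    rw [Complex.re_ofReal_mul]
    rcases le_total 0 η.re with h | h
    · refine le_trans ?_ hη
      gcongr
      exact mul_le_of_le_one_left h ht.2
    · refine (mul_le_of_le_one_left (norm_nonneg z) ?_).trans hz
      exact Real.exp_le_one_iff.2 (mul_nonpos_of_nonneg_of_nonpos ht.1 h)
  refine ⟨hnorm ζ _ hx.1 hy.1, ?_⟩
  have h := hnorm (-starRingEnd ℂ ζ) _ hx.2 hy.2
  rwa [wCoord_flow, map_mul, Complex.conj_ofReal, ← mul_neg]

/-- The point of the fibre `q = c` whose second complex coordinate is `δ`. At `c = 0` it lies on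
the stable plane of the flow of `q₂`. -/
noncomputable def stablePoint (δ : ℝ) (c : R2) : R4 :=
  ofComplex (starRingEnd ℂ (toComplex c) / δ) δ

/-- The point of the fibre `q = c` whose first complex coordinate is `δ`. At `c = 0` it lies on
the unstable plane of the flow of `q₂`. -/
noncomputable def unstablePoint (δ : ℝ) (c : R2) : R4 := ofComplex δ (toComplex c / δ)

variable {δ : ℝ}

theorem q_stablePoint (hδ : 0 < δ) (c : R2) : q (stablePoint δ c) = c := by
  have hδ' : (δ : ℂ) ≠ 0 := Complex.ofReal_ne_zero.2 hδ.ne'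
  rw [q_eq_iff, stablePoint, zCoord_ofComplex, wCoord_ofComplex, map_div₀, Complex.conj_conj,
    Complex.conj_ofReal, div_mul_cancel₀ _ hδ']

theorem q_unstablePoint (hδ : 0 < δ) (c : R2) : q (unstablePoint δ c) = c := by
  have hδ' : (δ : ℂ) ≠ 0 := Complex.ofReal_ne_zero.2 hδ.ne'
  rw [q_eq_iff, unstablePoint, zCoord_ofComplex, wCoord_ofComplex, Complex.conj_ofReal,
    mul_div_cancel₀ _ hδ']

theorem stablePoint_mem_bidisc (hδ : 0 < δ) {c : R2} (hc : ‖toComplex c‖ ≤ δ * δ) :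
    stablePoint δ c ∈ bidisc δ := by
  have hnorm : ‖(δ : ℂ)‖ = δ := Complex.norm_of_nonneg hδ.le
  refine ⟨?_, hnorm.le⟩
  rwa [stablePoint, zCoord_ofComplex, norm_div, RCLike.norm_conj, hnorm, div_le_iff₀ hδ]

theorem unstablePoint_mem_bidisc (hδ : 0 < δ) {c : R2} (hc : ‖toComplex c‖ ≤ δ * δ) :
    unstablePoint δ c ∈ bidisc δ := by
  have hnorm : ‖(δ : ℂ)‖ = δ := Complex.norm_of_nonneg hδ.le
  refine ⟨hnorm.le, ?_⟩
  rwa [unstablePoint, wCoord_ofComplex, norm_div, hnorm, div_le_iff₀ hδ]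

theorem stablePoint_ne_zero (hδ : 0 < δ) (c : R2) : stablePoint δ c ≠ 0 := fun h =>
  hδ.ne' (congrFun h 1)

theorem unstablePoint_ne_zero (hδ : 0 < δ) (c : R2) : unstablePoint δ c ≠ 0 := fun h =>
  hδ.ne' (congrFun h 0)

theorem contDiff_ofComplex {E : Type*} [NormedAddCommGroup E] [NormedSpace ℝ E] {z w : E → ℂ}
    (hz : ContDiff ℝ ∞ z) (hw : ContDiff ℝ ∞ w) :
    ContDiff ℝ ∞ fun x => ofComplex (z x) (w x) := by
  refine contDiff_pi.2 fun i => ?_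
  fin_cases i
  · exact Complex.reCLM.contDiff.comp hz
  · exact Complex.reCLM.contDiff.comp hw
  · exact Complex.imCLM.contDiff.comp hz
  · exact Complex.imCLM.contDiff.comp hw

theorem contDiff_stablePoint (δ : ℝ) : ContDiff ℝ ∞ (stablePoint δ) :=
  contDiff_ofComplex ((Complex.conjCLE.contDiff.comp toComplex.contDiff).div_const _)
    contDiff_const

theorem contDiff_unstablePoint (δ : ℝ) : ContDiff ℝ ∞ (unstablePoint δ) :=
  contDiff_ofComplex contDiff_const (toComplex.contDiff.div_const _)

theorem eventually_norm_toComplex_le (hδ : 0 < δ) :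
    ∀ᶠ c in 𝓝 (0 : R2), ‖toComplex c‖ ≤ δ * δ := by
  have h : Tendsto (fun c => ‖toComplex c‖) (𝓝 0) (𝓝 0) := by
    simpa only [map_zero, norm_zero] using toComplex.continuous.norm.tendsto 0
  exact h.eventually (Iic_mem_nhds (by positivity))

theorem map_q_nhds_zero : map q (𝓝 0) = 𝓝 0 := by
  refine le_antisymm q_tendsto fun s hs => ?_
  obtain ⟨δ, hs, hδ⟩ := ((eventually_forall_mem_bidisc hs).and self_mem_nhdsWithin).exists
  filter_upwards [eventually_norm_toComplex_le hδ] with c hc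
  simpa only [Set.mem_preimage, q_unstablePoint hδ] using hs _ (unstablePoint_mem_bidisc hδ hc)

end Bidisc

/-- A symplectic map `f` near the origin of `ℝ⁴` with `q ∘ f = g ∘ q`, where `k` is a local inverse
of `g`. -/
structure IsLocalLift (f : PointedMap R4) (g k : PointedMap R2) : Prop where
  symplectic : ∀ᶠ x in 𝓝 (0 : R4), ∀ u v,
    omegaCan (fderiv ℝ f.toFun x u) (fderiv ℝ f.toFun x v) = omegaCan u v
  lift : ∀ᶠ x in 𝓝 (0 : R4), q (f.toFun x) = g.toFun (q x)
  left_inv : ∀ᶠ c in 𝓝 (0 : R2), k.toFun (g.toFun c) = c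
  right_inv : ∀ᶠ c in 𝓝 (0 : R2), g.toFun (k.toFun c) = c
  ne_zero : ∀ᶠ x in 𝓝 (0 : R4), x ≠ 0 → f.toFun x ≠ 0

namespace IsLocalLift

variable {f : PointedMap R4} {g k : PointedMap R2}

theorem eventually_isLocalLiftAt (h : IsLocalLift f g k) :
    ∀ᶠ x in 𝓝 (0 : R4), IsLocalLiftAt f.toFun g.toFun k.toFun x := by
  have hinv : ∀ᶠ x in 𝓝 (0 : R4), k.toFun (q (f.toFun x)) = q x := by
    filter_upwards [h.lift, q_tendsto.eventually h.left_inv] with x hlift hinv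
    rw [hlift, hinv]
  filter_upwards [f.smooth, h.symplectic, h.lift,
    q_tendsto.eventually (g.tendsto.eventually k.smooth), hinv.eventually_nhds]
    with x hf hsymp hlift hk hinv
  exact ⟨hf.differentiableAt (by simp), hsymp, hlift, hk.differentiableAt (by simp), hinv⟩

theorem eventually_map_flow (h : IsLocalLift f g k) :
    ∀ᶠ δ in 𝓝[>] (0 : ℝ), ∀ x ∈ bidisc δ, ∀ ζ, flow ζ x ∈ bidisc δ →
      f.toFun (flow ζ x) = flow (pullback (fderiv ℝ k.toFun (g.toFun (q x))) ζ) (f.toFun x) := by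
  filter_upwards [eventually_forall_mem_bidisc h.eventually_isLocalLiftAt] with δ hδ x hx ζ hζ
  exact map_flow_of_isLocalLiftAt fun t ht => hδ _ (flow_mul_mem_bidisc hx hζ ht)

theorem inv_ne_zero (h : IsLocalLift f g k) :
    ∀ᶠ c in 𝓝 (0 : R2), c ≠ 0 → k.toFun c ≠ 0 := by
  filter_upwards [h.right_inv] with c hc h0 hk
  rw [hk, g.map_zero] at hc
  exact h0 hc.symm

theorem zCoord_map_ne_zero (h : IsLocalLift f g k) :
    ∀ᶠ x in 𝓝 (0 : R4), q x ≠ 0 → zCoord (f.toFun x) ≠ 0 := by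
  filter_upwards [h.lift, q_tendsto.eventually h.left_inv] with x hlift hinv hq hz
  refine hq ?_
  have h0 : g.toFun (q x) = 0 := by
    rw [← hlift, q_eq_iff, hz, map_zero, map_zero, zero_mul]
  rw [← hinv, h0, k.map_zero]

/-- The flow of `q₁` is `2π`-periodic, hence so is its image under `f`, while the periods of the
joint flow on `z ≠ 0` are multiples of `2π i`. -/
theorem fderiv_inv_map (h : IsLocalLift f g k) : ∀ᶠ c in 𝓝 (0 : R2), c ≠ 0 →
    fderiv ℝ k.toFun (g.toFun c) ![0, 1] 0 = 0 ∧
      ∃ n : ℤ, fderiv ℝ k.toFun (g.toFun c) ![1, 0] 0 = n := by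
  obtain ⟨δ, ⟨hflow, hz⟩, hδ⟩ := ((h.eventually_map_flow.and
    (eventually_forall_mem_bidisc h.zCoord_map_ne_zero)).and self_mem_nhdsWithin).exists
  filter_upwards [eventually_norm_toComplex_le hδ] with c hc hc0
  set x := stablePoint δ c
  have hx : x ∈ bidisc δ := stablePoint_mem_bidisc hδ hc
  have hqx : q x = c := q_stablePoint hδ c
  have hperiod := congrArg zCoord (hflow x hx (2 * Real.pi * Complex.I)
    (by rwa [flow_two_pi_mul_I]))
  rw [flow_two_pi_mul_I, zCoord_flow, hqx] at hperiod
  have hexp := (mul_eq_right₀ (hz x hx (by rwa [hqx]))).1 hperiod.symm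
  obtain ⟨n, hn⟩ := Complex.exp_eq_one_iff.1 hexp
  have hre : fderiv ℝ k.toFun (g.toFun c) ![0, 1] 0 = 0 := by
    simpa [pullback, pairing] using congrArg Complex.re hn
  have him : 2 * Real.pi * fderiv ℝ k.toFun (g.toFun c) ![1, 0] 0 = n * (2 * Real.pi) := by
    simpa [pullback, pairing] using congrArg Complex.im hn
  exact ⟨hre, n, mul_left_cancel₀ Real.two_pi_pos.ne' (him.trans (mul_comm _ _))⟩

theorem eventually_fderiv_inv (h : IsLocalLift f g k) : ∀ᶠ c in 𝓝[≠] (0 : R2),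
    fderiv ℝ k.toFun c ![0, 1] 0 = 0 ∧ ∃ n : ℤ, fderiv ℝ k.toFun c ![1, 0] 0 = n := by
  refine eventually_nhdsWithin_iff.2 ?_
  filter_upwards [k.tendsto.eventually h.fderiv_inv_map, h.inv_ne_zero, h.right_inv]
    with c hk hk0 hinv hc
  rw [hinv] at hk
  exact hk (hk0 hc)

theorem exists_fderiv_inv_apply_zero_eq (h : IsLocalLift f g k) :
    ∃ n : ℤ, ∀ᶠ c in 𝓝 (0 : R2), ∀ v, fderiv ℝ k.toFun c v 0 = n * v 0 := by
  have hcont (v : R2) : ContinuousAt (fun c => fderiv ℝ k.toFun c v 0) 0 :=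
    continuousAt_pi.1 ((k.smooth.self_of_nhds.fderiv_right (m := ∞)
      (by simp)).continuousAt.clm_apply continuousAt_const) 0
  have hlim (v : R2) := (hcont v).tendsto.mono_left (nhdsWithin_le_nhds (s := {0}ᶜ))
  obtain ⟨n, hn⟩ : fderiv ℝ k.toFun 0 ![1, 0] 0 ∈ Set.range ((↑) : ℤ → ℝ) := by
    refine Int.isClosedEmbedding_coe_real.isClosed_range.mem_of_tendsto (hlim ![1, 0]) ?_
    filter_upwards [h.eventually_fderiv_inv] with c ⟨_, m, hm⟩ using ⟨m, hm.symm⟩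
  have hn' : fderiv ℝ k.toFun 0 ![0, 1] 0 = 0 :=
    tendsto_nhds_unique_of_eventuallyEq (hlim ![0, 1]) tendsto_const_nhds
      (h.eventually_fderiv_inv.mono fun c hc => hc.1)
  have hnear : ∀ᶠ c in 𝓝 (0 : R2), dist (fderiv ℝ k.toFun c ![1, 0] 0) n < 1 := by
    have hball := (hcont ![1, 0]).tendsto.eventually (Metric.ball_mem_nhds _ one_pos)
    rwa [← hn] at hball
  refine ⟨n, ?_⟩
  filter_upwards [eventually_nhdsWithin_iff.1 h.eventually_fderiv_inv, hnear] with c hc hdist v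
  have hpart : fderiv ℝ k.toFun c ![0, 1] 0 = 0 ∧ fderiv ℝ k.toFun c ![1, 0] 0 = n := by
    rcases eq_or_ne c 0 with rfl | hc0
    · exact ⟨hn', hn.symm⟩
    · obtain ⟨h0, m, hm⟩ := hc hc0
      rw [hm, Int.dist_cast_real, Int.dist_eq] at hdist
      have hmn : |m - n| < 1 := by exact_mod_cast hdist
      exact ⟨h0, by rw [hm, sub_eq_zero.1 (Int.abs_lt_one_iff.1 hmn)]⟩
  rw [clm_apply_eq_smul_add_smul, Pi.add_apply, Pi.smul_apply, Pi.smul_apply, hpart.1, hpart.2,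
    smul_zero, add_zero, smul_eq_mul, mul_comm]

theorem exists_inv_apply_zero_eq (h : IsLocalLift f g k) : ∃ n : ℤ,
    ∀ᶠ c in 𝓝 (0 : R2), k.toFun c 0 = n * c 0 ∧ ∀ v, fderiv ℝ k.toFun c v 0 = n * v 0 := by
  obtain ⟨n, hn⟩ := h.exists_fderiv_inv_apply_zero_eq
  obtain ⟨ε, hε, hball⟩ := Metric.eventually_nhds_iff_ball.1 (hn.and k.smooth)
  have hfst (c : R2) (hc : c ∈ Metric.ball 0 ε) : HasFDerivAt (fun c => k.toFun c 0)
      ((ContinuousLinearMap.proj (0 : Fin 2)).comp (fderiv ℝ k.toFun c)) c :=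
    hasFDerivAt_pi'.1 ((hball c hc).2.differentiableAt (by simp)).hasFDerivAt 0
  have hmul (c : R2) : HasFDerivAt (fun c : R2 => (n : ℝ) * c 0)
      ((n : ℝ) • ContinuousLinearMap.proj (R := ℝ) (φ := fun _ => ℝ) (0 : Fin 2)) c :=
    (hasFDerivAt_apply 0 c).const_mul (n : ℝ)
  have heq : Set.EqOn (fun c => k.toFun c 0) (fun c => n * c 0) (Metric.ball (0 : R2) ε) := by
    refine Metric.isOpen_ball.eqOn_of_fderiv_eq (convex_ball _ _).isPreconnected
      (fun c hc => (hfst c hc).differentiableAt.differentiableWithinAt)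
      (fun c _ => (hmul c).differentiableAt.differentiableWithinAt) (fun c hc => ?_)
      (Metric.mem_ball_self hε) (by simp [k.map_zero])
    rw [(hfst c hc).fderiv, (hmul c).fderiv]
    ext v
    exact (hball c hc).1 v
  refine ⟨n, ?_⟩
  filter_upwards [Metric.ball_mem_nhds (0 : R2) hε, hn] with c hc hn using ⟨heq hc, hn⟩

end IsLocalLift

/-! ### Passage near the singular point -/

section Passage

variable {δ : ℝ} {c : R2}

/-- The complex time, with imaginary part chosen by the branch of `Complex.log`, in which the joint
flow takes `stablePoint δ c` to `unstablePoint δ c`. -/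
noncomputable def passageTime (δ : ℝ) (c : R2) : ℂ :=
  Complex.log (δ * δ / starRingEnd ℂ (toComplex c))

theorem re_passageTime (hδ : 0 < δ) (c : R2) :
    (passageTime δ c).re = Real.log (δ * δ / ‖toComplex c‖) := by
  rw [passageTime, Complex.log_re, norm_div, norm_mul, Complex.norm_of_nonneg hδ.le,
    RCLike.norm_conj]

theorem flow_passageTime_stablePoint (hδ : 0 < δ) (hc : c ≠ 0) :
    flow (passageTime δ c) (stablePoint δ c) = unstablePoint δ c := by
  have hδ' : (δ : ℂ) ≠ 0 := Complex.ofReal_ne_zero.2 hδ.ne'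
  have hc' := toComplex_ne_zero hc
  have hconj : starRingEnd ℂ (toComplex c) ≠ 0 := (map_ne_zero _).2 hc'
  have hexp : Complex.exp (passageTime δ c) = δ * δ / starRingEnd ℂ (toComplex c) :=
    Complex.exp_log (div_ne_zero (mul_ne_zero hδ' hδ') hconj)
  have hexp' : Complex.exp (-starRingEnd ℂ (passageTime δ c)) = toComplex c / (δ * δ) := by
    rw [Complex.exp_neg, Complex.exp_conj, hexp, map_div₀, map_mul, Complex.conj_ofReal,
      Complex.conj_conj, inv_div]
  refine eq_of_zCoord_eq_of_wCoord_eq ?_ ?_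
  · rw [zCoord_flow, hexp, stablePoint, unstablePoint, zCoord_ofComplex, zCoord_ofComplex]
    field_simp
  · rw [wCoord_flow, hexp', stablePoint, unstablePoint, wCoord_ofComplex, wCoord_ofComplex]
    field_simp

theorem tendsto_re_passageTime (hδ : 0 < δ) :
    Tendsto (fun c => (passageTime δ c).re) (𝓝[≠] 0) atTop := by
  have hnorm : Tendsto (fun c => ‖toComplex c‖) (𝓝[≠] 0) (𝓝[>] 0) := by
    refine tendsto_nhdsWithin_iff.2 ⟨?_, ?_⟩
    · simpa only [map_zero, norm_zero] using
        (toComplex.continuous.norm.tendsto 0).mono_left nhdsWithin_le_nhds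
    · filter_upwards [self_mem_nhdsWithin] with c hc using norm_pos_iff.2 (toComplex_ne_zero hc)
  simp only [re_passageTime hδ]
  exact Real.tendsto_log_atTop.comp
    ((tendsto_inv_nhdsGT_zero.comp hnorm).const_mul_atTop (mul_pos hδ hδ))

theorem limit_eq_zero_of_eq_exp_mul {X : Type*} {l : Filter X} [l.NeBot] {F G r : X → ℝ}
    {F₀ G₀ : ℝ} (hF : Tendsto F l (𝓝 F₀)) (hG : Tendsto G l (𝓝 G₀))
    (hr : Tendsto (fun x => |r x|) l atTop) (h : ∀ᶠ x in l, F x = Real.exp (r x) * G x)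
    (hF₀ : F₀ ≠ 0) : G₀ = 0 := by
  by_contra hG₀
  have hlog : Tendsto r l (𝓝 (Real.log F₀ - Real.log G₀)) := by
    refine ((hF.log hF₀).sub (hG.log hG₀)).congr' ?_
    filter_upwards [h, hG.eventually_ne hG₀] with x hx hGx
    rw [hx, Real.log_mul (Real.exp_ne_zero _) hGx, Real.log_exp, add_sub_cancel_right]
  exact not_tendsto_nhds_of_tendsto_atTop hr _ hlog.abs

theorem coord_eq_zero_or_of_tendsto_flow {ι : Type*} {l : Filter ι} [l.NeBot] {X Y : ι → R4}
    {τ : ι → ℂ} {X₀ Y₀ : R4} (hX : Tendsto X l (𝓝 X₀)) (hY : Tendsto Y l (𝓝 Y₀))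
    (hflow : ∀ᶠ i in l, Y i = flow (τ i) (X i)) (hτ : Tendsto (fun i => |(τ i).re|) l atTop) :
    (zCoord X₀ = 0 ∨ zCoord Y₀ = 0) ∧ (wCoord X₀ = 0 ∨ wCoord Y₀ = 0) := by
  have tendsto_normSq (L : R4 →L[ℝ] ℂ) {Z : ι → R4} {Z₀ : R4} (hZ : Tendsto Z l (𝓝 Z₀)) :
      Tendsto (fun i => Complex.normSq (L (Z i))) l (𝓝 (Complex.normSq (L Z₀))) :=
    ((contDiff_normSq_comp L).continuous.tendsto Z₀).comp hZ
  have hτ₂ : Tendsto (fun i => |2 * (τ i).re|) l atTop := by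
    simpa only [abs_mul, Nat.abs_ofNat] using hτ.const_mul_atTop two_pos
  refine ⟨or_iff_not_imp_right.2 fun hYz => ?_, or_iff_not_imp_right.2 fun hYw => ?_⟩
  · exact Complex.normSq_eq_zero.1 <| limit_eq_zero_of_eq_exp_mul (tendsto_normSq zCoord hY)
      (tendsto_normSq zCoord hX) hτ₂ (hflow.mono fun i hi => by rw [hi, normSq_zCoord_flow])
      (mt Complex.normSq_eq_zero.1 hYz)
  · exact Complex.normSq_eq_zero.1 <| limit_eq_zero_of_eq_exp_mul (tendsto_normSq wCoord hY)
      (tendsto_normSq wCoord hX) (r := fun i => -(2 * (τ i).re)) (by simpa only [abs_neg] using hτ₂)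
      (hflow.mono fun i hi => by rw [hi, normSq_wCoord_flow]) (mt Complex.normSq_eq_zero.1 hYw)

theorem zCoord_ne_zero_or_wCoord_ne_zero {x : R4} (hx : x ≠ 0) : zCoord x ≠ 0 ∨ wCoord x ≠ 0 := by
  contrapose! hx
  exact eq_of_zCoord_eq_of_wCoord_eq (by simp [hx.1]) (by simp [hx.2])

-- Over a long passage time the orbit cannot keep its `z`-coordinate (or its `w`-coordinate) bounded
-- away from zero at both ends, so it runs from the `w`-plane to the `z`-plane or back.
theorem exists_sum_sq_q_eq_exp_mul {X Y : R2 → R4} {τ : R2 → ℂ}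
    (hX : ∀ᶠ c in 𝓝 0, ContDiffAt ℝ ∞ X c) (hY : ∀ᶠ c in 𝓝 0, ContDiffAt ℝ ∞ Y c)
    (hX₀ : X 0 ≠ 0) (hY₀ : Y 0 ≠ 0) (hflow : ∀ᶠ c in 𝓝[≠] 0, Y c = flow (τ c) (X c))
    (hτ : Tendsto (fun c => |(τ c).re|) (𝓝[≠] 0) atTop) :
    ∃ (σ : ℤˣ) (P : R2 → ℝ), (∀ᶠ c in 𝓝 0, ContDiffAt ℝ ∞ P c) ∧ P 0 ≠ 0 ∧
      ∀ᶠ c in 𝓝[≠] 0,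
        q (X c) 0 ^ 2 + q (X c) 1 ^ 2 = Real.exp (-(2 * ((σ : ℤ) * (τ c).re))) * P c := by
  have hsmooth (L : R4 →L[ℝ] ℂ) {Z : R2 → R4} {c : R2} (hZ : ContDiffAt ℝ ∞ Z c) :
      ContDiffAt ℝ ∞ (fun c => Complex.normSq (L (Z c))) c :=
    (contDiff_normSq_comp L).contDiffAt.comp c hZ
  obtain ⟨hz, hw⟩ := coord_eq_zero_or_of_tendsto_flow
    (hX.self_of_nhds.continuousAt.mono_left nhdsWithin_le_nhds)
    (hY.self_of_nhds.continuousAt.mono_left nhdsWithin_le_nhds) hflow hτ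
  rcases zCoord_ne_zero_or_wCoord_ne_zero hY₀ with hYz | hYw
  · have hXw : wCoord (X 0) ≠ 0 :=
      (zCoord_ne_zero_or_wCoord_ne_zero hX₀).resolve_left (not_not.2 (hz.resolve_right hYz))
    refine ⟨1, fun c => Complex.normSq (zCoord (Y c)) * Complex.normSq (wCoord (X c)), ?_, ?_, ?_⟩
    · filter_upwards [hX, hY] with c hX hY using (hsmooth zCoord hY).mul (hsmooth wCoord hX)
    · exact mul_ne_zero (mt Complex.normSq_eq_zero.1 hYz) (mt Complex.normSq_eq_zero.1 hXw)
    · filter_upwards [hflow] with c hc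
      rw [← normSq_zCoord_mul_normSq_wCoord, hc, normSq_zCoord_flow, Units.val_one, Int.cast_one,
        one_mul, ← mul_assoc, ← mul_assoc, ← Real.exp_add, neg_add_cancel, Real.exp_zero, one_mul]
  · have hXz : zCoord (X 0) ≠ 0 :=
      (zCoord_ne_zero_or_wCoord_ne_zero hX₀).resolve_right (not_not.2 (hw.resolve_right hYw))
    refine ⟨-1, fun c => Complex.normSq (wCoord (Y c)) * Complex.normSq (zCoord (X c)), ?_, ?_, ?_⟩
    · filter_upwards [hX, hY] with c hX hY using (hsmooth wCoord hY).mul (hsmooth zCoord hX)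
    · exact mul_ne_zero (mt Complex.normSq_eq_zero.1 hYw) (mt Complex.normSq_eq_zero.1 hXz)
    · filter_upwards [hflow] with c hc
      rw [← normSq_zCoord_mul_normSq_wCoord, hc, normSq_wCoord_flow, ← mul_assoc, ← mul_assoc,
        ← Real.exp_add, Units.val_neg, Units.val_one, Int.cast_neg, Int.cast_one, neg_one_mul,
        mul_neg, neg_neg, add_neg_cancel, Real.exp_zero, one_mul, mul_comm]

end Passage

namespace IsLocalLift

variable {f : PointedMap R4} {g k : PointedMap R2}

theorem fderiv_inv_zero_ne_zero (h : IsLocalLift f g k) {n : ℤ}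
    (hn : ∀ v, fderiv ℝ k.toFun 0 v 0 = n * v 0) : fderiv ℝ k.toFun 0 ![0, 1] 1 ≠ 0 := by
  intro h1
  have hk := (k.smooth.self_of_nhds.differentiableAt (by simp)).hasFDerivAt
  have hg := (g.smooth.self_of_nhds.differentiableAt (by simp)).hasFDerivAt
  rw [← k.map_zero] at hg
  have hcomp := (hg.comp 0 hk).unique
    ((hasFDerivAt_id (0 : R2)).congr_of_eventuallyEq h.right_inv)
  have h0 : fderiv ℝ k.toFun 0 ![0, 1] = 0 := by
    ext i
    fin_cases i
    · simpa using hn ![0, 1]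
    · exact h1
  simpa [h0] using congrArg (fun L => L ![0, 1] 1) hcomp

theorem exists_passage (h : IsLocalLift f g k) {n : ℤ}
    (hn : ∀ᶠ c in 𝓝 (0 : R2), ∀ v, fderiv ℝ k.toFun c v 0 = n * v 0) :
    ∃ δ > 0, ∃ (X Y : R2 → R4) (τ : R2 → ℂ), (∀ᶠ c in 𝓝 0, ContDiffAt ℝ ∞ X c) ∧
      (∀ᶠ c in 𝓝 0, ContDiffAt ℝ ∞ Y c) ∧ X 0 ≠ 0 ∧ Y 0 ≠ 0 ∧
      (∀ᶠ c in 𝓝 0, q (X c) = g.toFun c) ∧ ∀ᶠ c in 𝓝[≠] 0, Y c = flow (τ c) (X c) ∧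
        (τ c).re = fderiv ℝ k.toFun (g.toFun c) ![0, 1] 1 * (passageTime δ c).re := by
  obtain ⟨δ, ⟨⟨hflow, hprop⟩, hδ⟩⟩ := ((h.eventually_map_flow.and (eventually_forall_mem_bidisc
    (f.smooth.and (h.lift.and h.ne_zero)))).and self_mem_nhdsWithin).exists
  have hsmall := eventually_norm_toComplex_le hδ
  have hs {c : R2} (hc : ‖toComplex c‖ ≤ δ * δ) := hprop _ (stablePoint_mem_bidisc hδ hc)
  have hu {c : R2} (hc : ‖toComplex c‖ ≤ δ * δ) := hprop _ (unstablePoint_mem_bidisc hδ hc)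
  refine ⟨δ, hδ, fun c => f.toFun (stablePoint δ c), fun c => f.toFun (unstablePoint δ c),
    fun c => pullback (fderiv ℝ k.toFun (g.toFun c)) (passageTime δ c), ?_, ?_, ?_, ?_, ?_, ?_⟩
  · filter_upwards [hsmall] with c hc using (hs hc).1.comp c (contDiff_stablePoint δ).contDiffAt
  · filter_upwards [hsmall] with c hc using (hu hc).1.comp c (contDiff_unstablePoint δ).contDiffAt
  · exact (hs hsmall.self_of_nhds).2.2 (stablePoint_ne_zero hδ 0)
  · exact (hu hsmall.self_of_nhds).2.2 (unstablePoint_ne_zero hδ 0)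
  · filter_upwards [hsmall] with c hc
    rw [(hs hc).2.1, q_stablePoint hδ]
  · refine eventually_nhdsWithin_iff.2 ?_
    filter_upwards [hsmall, g.tendsto.eventually hn] with c hc hn hc0
    have hmap := hflow _ (stablePoint_mem_bidisc hδ hc) (passageTime δ c)
    rw [flow_passageTime_stablePoint hδ hc0, q_stablePoint hδ] at hmap
    refine ⟨hmap (unstablePoint_mem_bidisc hδ hc), ?_⟩
    simp [pullback, pairing, hn, mul_comm]

theorem exists_log_relation (h : IsLocalLift f g k) {n : ℤ}
    (hn : ∀ᶠ c in 𝓝 (0 : R2), ∀ v, fderiv ℝ k.toFun c v 0 = n * v 0) :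
    ∃ (σ : ℤˣ) (S : R2 → ℝ), (∀ᶠ c in 𝓝 (0 : R2), ContDiffAt ℝ ∞ S c) ∧
      ∀ᶠ c in 𝓝[≠] 0, Real.log (g.toFun c 0 ^ 2 + g.toFun c 1 ^ 2) =
        (σ : ℤ) * fderiv ℝ k.toFun (g.toFun c) ![0, 1] 1 * Real.log (c 0 ^ 2 + c 1 ^ 2) + S c := by
  obtain ⟨δ, hδ, X, Y, τ, hX, hY, hX₀, hY₀, hq, hτ⟩ := h.exists_passage hn
  set κ : R2 → ℝ := fun c => fderiv ℝ k.toFun (g.toFun c) ![0, 1] 1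
  have hκ : ∀ᶠ c in 𝓝 (0 : R2), ContDiffAt ℝ ∞ κ c := by
    filter_upwards [g.smooth, g.tendsto.eventually k.smooth] with c hg hk
    exact contDiffAt_pi.1 (((hk.fderiv_right (m := ∞) (by simp)).comp c hg).clm_apply
      contDiffAt_const) 1
  have hκ₀ : κ 0 ≠ 0 := by
    simpa only [κ, g.map_zero] using h.fderiv_inv_zero_ne_zero hn.self_of_nhds
  have hτ_lim : Tendsto (fun c => |(τ c).re|) (𝓝[≠] 0) atTop := by
    have hκ_lim := hκ.self_of_nhds.continuousAt.abs.tendsto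
    refine ((hκ_lim.mono_left nhdsWithin_le_nhds).pos_mul_atTop (abs_pos.2 hκ₀)
      (tendsto_abs_atTop_atTop.comp (tendsto_re_passageTime hδ))).congr' ?_
    filter_upwards [hτ] with c hc
    rw [hc.2, abs_mul, Function.comp_apply]
  obtain ⟨σ, P, hP, hP₀, hrel⟩ := exists_sum_sq_q_eq_exp_mul hX hY hX₀ hY₀
    (hτ.mono fun c hc => hc.1) hτ_lim
  have hP_ne := hP.self_of_nhds.continuousAt.eventually_ne hP₀
  refine ⟨σ, fun c => Real.log (P c) - (σ : ℤ) * κ c * (2 * Real.log (δ * δ)), ?_, ?_⟩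
  · filter_upwards [hP, hP_ne, hκ] with c hP hPc hκ
    exact (hP.log hPc).sub ((contDiffAt_const.mul hκ).mul contDiffAt_const)
  · filter_upwards [hrel, hτ, hq.filter_mono nhdsWithin_le_nhds,
      hP_ne.filter_mono nhdsWithin_le_nhds, self_mem_nhdsWithin] with c hrel hτ hq hPc hc
    rw [hq] at hrel
    have hnorm : ‖toComplex c‖ ≠ 0 := norm_ne_zero_iff.2 (toComplex_ne_zero hc)
    simp only [κ]
    rw [hrel, Real.log_mul (Real.exp_ne_zero _) hPc, Real.log_exp, hτ.2,
      re_passageTime hδ, Real.log_div (mul_pos hδ hδ).ne' hnorm, ← normSq_toComplex,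
      Complex.normSq_eq_norm_sq, Real.log_pow]
    push_cast
    ring

end IsLocalLift

/-! ### Intertwined germs lie in `G` -/

theorem units_coe_mul_self_real (ε : ℤˣ) : ((ε : ℤ) : ℝ) * ((ε : ℤ) : ℝ) = 1 := by
  exact_mod_cast Int.units_coe_mul_self ε

namespace IsLocalLift

variable {f : PointedMap R4} {g k : PointedMap R2}

theorem exists_logRelation_inv (h : IsLocalLift f g k) {ε : ℤˣ}
    (hε : ∀ᶠ c in 𝓝 (0 : R2),
      k.toFun c 0 = (ε : ℤ) * c 0 ∧ ∀ v, fderiv ℝ k.toFun c v 0 = (ε : ℤ) * v 0) :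
    ∃ (σ : ℤˣ) (u S : R2 → ℝ), ContDiff ℝ ∞ u ∧ ContDiff ℝ ∞ S ∧
      u =ᶠ[𝓝 0] (fun c => (σ : ℤ) * k.toFun c 1) ∧ LogRelation u S := by
  obtain ⟨σ, S, hS, hlog⟩ := h.exists_log_relation (hε.mono fun c hc => hc.2)
  have hk_smooth : ∀ᶠ c in 𝓝 (0 : R2),
      ContDiffAt ℝ ∞ (fun c => ((σ : ℤ) : ℝ) * k.toFun c 1) c :=
    k.smooth.mono fun c hc => contDiffAt_const.mul (contDiffAt_pi.1 hc 1)
  have hSk_smooth : ∀ᶠ c in 𝓝 (0 : R2), ContDiffAt ℝ ∞ (fun c => -S (k.toFun c)) c := by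
    filter_upwards [k.smooth, k.tendsto.eventually hS] with c hk hS using (hS.comp c hk).neg
  obtain ⟨u, hu, hu_eq⟩ := exists_contDiff_eventuallyEq hk_smooth
  obtain ⟨T, hT, hT_eq⟩ := exists_contDiff_eventuallyEq hSk_smooth
  refine ⟨σ, u, T, hu, hT, hu_eq, ?_⟩
  filter_upwards [hu_eq.eventually_nhds, hT_eq,
    k.tendsto.eventually (eventually_nhdsWithin_iff.1 hlog), h.inv_ne_zero, h.right_inv, hε,
    k.smooth] with c hu_eq hT_eq hlog hk0 hgk hε hk hc
  have hlog := hlog (hk0 fun h0 => hc (by simp [h0]))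
  have hsq (τ : ℤˣ) (x : ℝ) : ((τ : ℤ) * x) ^ 2 = x ^ 2 := by
    rw [mul_pow, pow_two (_ : ℝ), units_coe_mul_self_real, one_mul]
  have hu_deriv : fderiv ℝ u c ![0, 1] = (σ : ℤ) * fderiv ℝ k.toFun c ![0, 1] 1 := by
    rw [EventuallyEq.fderiv_eq hu_eq, ((hasFDerivAt_pi'.1
      (hk.differentiableAt (by simp)).hasFDerivAt 1).const_mul ((σ : ℤ) : ℝ)).fderiv]
    simp
  rw [hgk, hε.1, hsq] at hlog
  rw [hu_deriv, hu_eq.self_of_nhds, hsq, hT_eq, hlog]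
  ring

theorem exists_isFlat_inv_apply_one_sub (h : IsLocalLift f g k) {ε : ℤˣ}
    (hε : ∀ᶠ c in 𝓝 (0 : R2),
      k.toFun c 0 = (ε : ℤ) * c 0 ∧ ∀ v, fderiv ℝ k.toFun c v 0 = (ε : ℤ) * v 0) :
    ∃ σ : ℤˣ, IsFlat fun c => k.toFun c 1 - (σ : ℤ) * c 1 := by
  obtain ⟨σ, u, S, hu, hS, hu_eq, hrel⟩ := h.exists_logRelation_inv hε
  have hu0 : u 0 = 0 := by simp [hu_eq.self_of_nhds, k.map_zero]
  have hsmooth : ∀ᶠ c in 𝓝 (0 : R2),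
      ContDiffAt ℝ ∞ (fun c => k.toFun c 1 - ((σ : ℤ) : ℝ) * c 1) c := by
    filter_upwards [k.smooth] with c hc
    exact (contDiffAt_pi.1 hc 1).sub (contDiffAt_const.mul (contDiff_apply ℝ ℝ 1).contDiffAt)
  have hvanish : VanishesToInfiniteOrder fun c => k.toFun c 1 - ((σ : ℤ) : ℝ) * c 1 := by
    refine ((hrel.vanishesToInfiniteOrder_sub hu hS hu0).mul_of_continuousAt
      (l := fun _ => ((σ : ℤ) : ℝ)) continuousAt_const).congr ?_
    filter_upwards [hu_eq] with c hc
    rw [hc]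
    linear_combination k.toFun c 1 * units_coe_mul_self_real σ
  exact ⟨σ, hsmooth, hvanish.iteratedFDeriv_eq_zero hsmooth.self_of_nhds⟩

end IsLocalLift

theorem isLocalLift_of_germ_eq {φ : DiffeoGerm R4} {γ : DiffeoGerm R2} (hφ : IsSymplectic φ.val)
    (hφγ : Intertwines φ.val γ.val) {f : PointedMap R4} {g k : PointedMap R2}
    (hf : germ f = φ.val) (hg : germ g = γ.val) (hk : germ k = (γ⁻¹).val) :
    IsLocalLift f g k := by
  obtain ⟨f', hf'⟩ := germ_surj (φ⁻¹).val
  have hf'f : germ (f'.comp f) = 1 := by rw [← germ_mul, hf, hf', Units.inv_mul]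
  have hkg : germ (k.comp g) = 1 := by rw [← germ_mul, hk, hg, Units.inv_mul]
  have hgk : germ (g.comp k) = 1 := by rw [← germ_mul, hk, hg, Units.mul_inv]
  rw [germ_one, germ_eq_iff] at hf'f hkg hgk
  rw [← hf, isSymplectic_germ] at hφ
  rw [← hf, ← hg, intertwines_germ] at hφγ
  refine ⟨hφ, hφγ, hkg, hgk, ?_⟩
  filter_upwards [hf'f] with x hx hx0 hfx
  change f'.toFun (f.toFun x) = x at hx
  rw [hfx, f'.map_zero] at hx
  exact hx0 hx.symm

theorem IsSymplectic.inv {φ : DiffeoGerm R4} (h : IsSymplectic φ.val) : IsSymplectic (φ⁻¹).val :=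
  h.of_mul (by rw [Units.mul_inv]; exact IsSymplectic.one)

theorem eq_of_eventually_mul_apply_zero_eq {a b : ℝ}
    (h : ∀ᶠ c in 𝓝 (0 : R2), a * c 0 = b * c 0) : a = b := by
  have ht : Tendsto (fun t : ℝ => (![t, 0] : R2)) (𝓝[≠] 0) (𝓝 0) := by
    have hcont : Continuous fun t : ℝ => (![t, 0] : R2) := by fun_prop
    exact (hcont.tendsto' 0 0 (by simp)).mono_left nhdsWithin_le_nhds
  obtain ⟨t, ht, ht0⟩ := ((ht.eventually h).and self_mem_nhdsWithin).exists
  exact mul_right_cancel₀ ht0 ht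

theorem hasFlatForm_of_intertwines {φ : DiffeoGerm R4} {γ : DiffeoGerm R2}
    (hφ : IsSymplectic φ.val) (hφγ : Intertwines φ.val γ.val) : HasFlatForm γ.val := by
  obtain ⟨f, hf⟩ := germ_surj φ.val
  obtain ⟨f', hf'⟩ := germ_surj (φ⁻¹).val
  obtain ⟨g, hg⟩ := germ_surj γ.val
  obtain ⟨k, hk⟩ := germ_surj (γ⁻¹).val
  have hlift : IsLocalLift f g k := isLocalLift_of_germ_eq hφ hφγ hf hg hk
  have hlift' : IsLocalLift f' k g :=
    isLocalLift_of_germ_eq hφ.inv hφγ.inv hf' hk (by rwa [inv_inv])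
  obtain ⟨n, hn⟩ := hlift.exists_inv_apply_zero_eq
  obtain ⟨m, hm⟩ := hlift'.exists_inv_apply_zero_eq
  have hnm : (n * m : ℝ) = 1 := by
    refine eq_of_eventually_mul_apply_zero_eq ?_
    filter_upwards [hlift.left_inv, g.tendsto.eventually hn, hm] with c hkg hn hm
    rw [one_mul, mul_assoc, ← hm.1, ← hn.1, hkg]
  obtain ⟨ε, rfl⟩ := IsUnit.of_mul_eq_one m (by exact_mod_cast hnm)
  obtain ⟨σ, hσ⟩ := hlift.exists_isFlat_inv_apply_one_sub hn
  have hinv : HasFlatForm (γ⁻¹).val := by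
    refine ⟨k, hk, (ε, σ), _, hσ, ?_⟩
    filter_upwards [hn] with c hc
    ext i
    fin_cases i
    · exact hc.1
    · simp
  simpa only [inv_inv] using HasFlatForm.inv hinv

theorem intertwines_unique {φ : SmoothGerm R4} {γ γ' : SmoothGerm R2} (h : Intertwines φ γ)
    (h' : Intertwines φ γ') : γ = γ' := by
  obtain ⟨f, rfl⟩ := germ_surj φ
  obtain ⟨g, rfl⟩ := germ_surj γ
  obtain ⟨g', rfl⟩ := germ_surj γ'
  rw [intertwines_germ] at h h'
  rw [germ_eq_iff, ← map_q_nhds_zero]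
  refine eventually_map.2 ?_
  filter_upwards [h, h'] with x hx hx'
  rw [← hx, hx']

/-! ### Flat multipliers -/

section ModerateGrowth

/-- A smooth function on `(0, ∞)` each of whose derivatives grows at most like a power of `t⁻¹` at
`0`. Such a singularity is absorbed by flat factors, see `IsSmoothFlat.contDiff_smul_comp`. -/
structure HasModerateGrowth (l : ℝ → ℝ) : Prop where
  contDiffOn : ContDiffOn ℝ ∞ l (Set.Ioi 0)
  isBigO : ∀ n, ∃ m : ℕ, iteratedDeriv n l =O[𝓝[>] 0] fun t => t⁻¹ ^ m

theorem HasModerateGrowth.deriv {l : ℝ → ℝ} (hl : HasModerateGrowth l) :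
    HasModerateGrowth (deriv l) where
  contDiffOn := ((contDiffOn_infty_iff_deriv_of_isOpen isOpen_Ioi).1 hl.contDiffOn).2
  isBigO n := by
    rw [← iteratedDeriv_succ']
    exact hl.isBigO (n + 1)

theorem HasModerateGrowth.of_deriv {l : ℝ → ℝ} (hl : DifferentiableOn ℝ l (Set.Ioi 0))
    {m : ℕ} (hO : l =O[𝓝[>] 0] fun t => t⁻¹ ^ m) (hl' : HasModerateGrowth (_root_.deriv l)) :
    HasModerateGrowth l where
  contDiffOn := (contDiffOn_infty_iff_deriv_of_isOpen isOpen_Ioi).2 ⟨hl, hl'.contDiffOn⟩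
  isBigO
    | 0 => ⟨m, by rwa [iteratedDeriv_zero]⟩
    | n + 1 => by
      rw [iteratedDeriv_succ']
      exact hl'.isBigO n

theorem hasModerateGrowth_inv : HasModerateGrowth fun t => t⁻¹ where
  contDiffOn := contDiffOn_id.inv fun _ ht => (Set.mem_Ioi.1 ht).ne'
  isBigO n := by
    refine ⟨n + 1, Asymptotics.IsBigO.of_bound (n.factorial : ℝ) (Eventually.of_forall fun t => ?_)⟩
    have hexp : (-1 - n : ℤ) = -((n + 1 : ℕ) : ℤ) := by
      push_cast
      ring
    rw [iteratedDeriv_eq_iterate, show (fun t : ℝ => t⁻¹) = Inv.inv from rfl, iter_deriv_inv, hexp,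
      zpow_neg, zpow_natCast, ← inv_pow]
    simp

theorem hasModerateGrowth_log : HasModerateGrowth Real.log := by
  refine HasModerateGrowth.of_deriv (m := 1)
    (fun t ht => (Real.differentiableAt_log (Set.mem_Ioi.1 ht).ne').differentiableWithinAt) ?_ ?_
  · refine Asymptotics.IsBigO.of_bound 1 ?_
    filter_upwards [Ioo_mem_nhdsGT zero_lt_one] with t ht
    have hlt := Real.abs_log_mul_self_lt t ht.1 ht.2.le
    rw [abs_mul, abs_of_pos ht.1, ← lt_div_iff₀ ht.1] at hlt
    rw [pow_one, norm_inv, Real.norm_of_nonneg ht.1.le, ← div_eq_mul_inv]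
    exact hlt.le
  · rw [Real.deriv_log']
    exact hasModerateGrowth_inv

end ModerateGrowth

section FlatMultiplier

theorem eq_zero_of_isBigO_norm_sq {X F : Type*} [TopologicalSpace X] [NormedAddCommGroup F]
    {ρ : X → ℝ} {q : X → F} {x : X} (hq : (fun y => ‖q y‖ ^ 2) =O[𝓝 x] ρ) (hx : ρ x = 0) :
    q x = 0 :=
  norm_eq_zero.1 (pow_eq_zero_iff two_ne_zero |>.1 (hq.eq_zero_imp.self_of_nhds hx))

universe u

variable {F G : Type u} [NormedAddCommGroup F] [NormedSpace ℝ F]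
  [NormedAddCommGroup G] [NormedSpace ℝ G]

/-- A smooth function, defined on the whole space, whose Taylor series at the origin is zero. -/
structure IsSmoothFlat (k : F → G) : Prop where
  contDiff : ContDiff ℝ ∞ k
  vanishesToInfiniteOrder : VanishesToInfiniteOrder k

theorem IsSmoothFlat.apply_zero {k : F → G} (hk : IsSmoothFlat k) : k 0 = 0 :=
  hk.vanishesToInfiniteOrder.apply_zero

theorem IsSmoothFlat.fderiv {k : F → G} (hk : IsSmoothFlat k) : IsSmoothFlat (fderiv ℝ k) where
  contDiff := hk.contDiff.fderiv_right (by simp)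
  vanishesToInfiniteOrder := by
    refine (vanishesToInfiniteOrder_iff (hk.contDiff.fderiv_right (by simp))).2 fun n => ?_
    rw [← norm_eq_zero, norm_iteratedFDeriv_fderiv, norm_eq_zero]
    exact (vanishesToInfiniteOrder_iff hk.contDiff).1 hk.vanishesToInfiniteOrder (n + 1)

theorem IsSmoothFlat.isBigO_smul_comp {X : Type*} [TopologicalSpace X] {ρ : X → ℝ} {q : X → F}
    {l : ℝ → ℝ} {k : F → G} (hk : IsSmoothFlat k) (hl : HasModerateGrowth l)
    (hρ : Continuous ρ) (hρ0 : ∀ x, 0 ≤ ρ x) (hq : Continuous q)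
    (hqρ : ∀ x, ρ x = 0 → (fun y => ‖q y‖ ^ 2) =O[𝓝 x] ρ) {x : X} (hx : ρ x = 0) :
    (fun y => l (ρ y) • k (q y)) =O[𝓝 x] ρ := by
  have q_eq_zero {y : X} (hy : ρ y = 0) : q y = 0 := eq_zero_of_isBigO_norm_sq (hqρ y hy) hy
  obtain ⟨m, hm⟩ := hl.isBigO 0
  rw [iteratedDeriv_zero] at hm
  obtain ⟨C, hC0, hC⟩ := hm.exists_nonneg
  have l_bound : ∀ᶠ y in 𝓝 x, 0 < ρ y → ‖l (ρ y)‖ ≤ C * ‖(ρ y)⁻¹ ^ m‖ :=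
    (hρ.tendsto' x 0 hx).eventually (eventually_nhdsWithin_iff.1 hC.bound)
  have k_isBigO : (fun y => k (q y)) =O[𝓝 x] fun y => ρ y ^ (m + 1) := by
    have := (hk.vanishesToInfiniteOrder (2 * (m + 1))).comp_tendsto (hq.tendsto' x 0 (q_eq_zero hx))
    simp only [Function.comp_def, pow_mul] at this
    exact this.trans ((hqρ x hx).pow _)
  obtain ⟨D, hD⟩ := k_isBigO.bound
  refine Asymptotics.IsBigO.of_bound (C * D) ?_
  filter_upwards [l_bound, hD] with y hly hky
  rcases (hρ0 y).eq_or_lt with hy | hy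
  · rw [q_eq_zero hy.symm, hk.apply_zero, smul_zero, norm_zero, ← hy, norm_zero, mul_zero]
  · calc ‖l (ρ y) • k (q y)‖ ≤ C * ‖(ρ y)⁻¹ ^ m‖ * (D * ‖ρ y ^ (m + 1)‖) := by
          rw [norm_smul]
          gcongr
          exact hly hy
      _ = C * D * ‖(ρ y)⁻¹ ^ m * ρ y ^ (m + 1)‖ := by
          rw [norm_mul]
          ring
      _ = C * D * ‖ρ y‖ := by
          rw [pow_succ, ← mul_assoc, inv_pow, inv_mul_cancel₀ (pow_ne_zero _ hy.ne'), one_mul]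

variable {E : Type*} [NormedAddCommGroup E] [NormedSpace ℝ E] {ρ : E → ℝ} {q : E → F}

theorem fderiv_eq_zero_of_nonneg (hρ0 : ∀ x, 0 ≤ ρ x) {x : E} (hx : ρ x = 0) :
    fderiv ℝ ρ x = 0 :=
  IsLocalMin.fderiv_eq_zero (Eventually.of_forall fun y => hx ▸ hρ0 y)

theorem isBigO_norm_sub_sq_of_nonneg (hρ : ContDiff ℝ ∞ ρ) (hρ0 : ∀ x, 0 ≤ ρ x) {x : E}
    (hx : ρ x = 0) : ρ =O[𝓝 x] fun y => ‖y - x‖ ^ 2 := by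
  have := (isBigO_sub_sub_fderiv (hρ.contDiffAt.of_le (WithTop.coe_le_coe.2 le_top))).comp_tendsto
    ((tendsto_const_nhds (x := x)).prodMk_nhds tendsto_id)
  simpa only [Function.comp_def, id, hx, fderiv_eq_zero_of_nonneg hρ0 hx, sub_zero,
    zero_apply] using this

theorem IsSmoothFlat.hasFDerivAt_smul_comp {l : ℝ → ℝ} {k : F → G} (hk : IsSmoothFlat k)
    (hl : HasModerateGrowth l) (hρ : ContDiff ℝ ∞ ρ) (hρ0 : ∀ x, 0 ≤ ρ x) (hq : ContDiff ℝ ∞ q)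
    (hqρ : ∀ x, ρ x = 0 → (fun y => ‖q y‖ ^ 2) =O[𝓝 x] ρ) (x : E) :
    HasFDerivAt (fun x => l (ρ x) • k (q x))
      ((l (ρ x) • _root_.fderiv ℝ k (q x)).comp (_root_.fderiv ℝ q x) +
        (_root_.fderiv ℝ ρ x).smulRight (_root_.deriv l (ρ x) • k (q x))) x := by
  rcases (hρ0 x).eq_or_lt with hx | hx
  · have hqx : q x = 0 := eq_zero_of_isBigO_norm_sq (hqρ x hx.symm) hx.symm
    have := Asymptotics.IsBigO.hasFDerivAt (𝕜 := ℝ)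
      ((hk.isBigO_smul_comp hl hρ.continuous hρ0 hq.continuous hqρ hx.symm).trans
        (isBigO_norm_sub_sq_of_nonneg hρ hρ0 hx.symm)) one_lt_two
    rwa [hqx, hk.fderiv.apply_zero, hk.apply_zero, smul_zero, ContinuousLinearMap.zero_comp,
      smul_zero, ContinuousLinearMap.smulRight_zero, add_zero]
  · have hlx : HasDerivAt l (_root_.deriv l (ρ x)) (ρ x) :=
      ((hl.contDiffOn.contDiffAt (Ioi_mem_nhds hx)).differentiableAt (by simp)).hasDerivAt
    have hρx := (hρ.differentiable (by simp) x).hasFDerivAt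
    have hkx := (hk.contDiff.differentiable (by simp) (q x)).hasFDerivAt.comp x
      (hq.differentiable (by simp) x).hasFDerivAt
    refine ((hlx.comp_hasFDerivAt x hρx).smul hkx).congr_fderiv ?_
    ext v
    simp [smul_smul, mul_comm]

/-- `F` and `G` share a universe because the induction on the order of smoothness replaces `k` by
its derivative. -/
theorem IsSmoothFlat.contDiff_smul_comp {l : ℝ → ℝ} {k : F → G} (hk : IsSmoothFlat k)
    (hl : HasModerateGrowth l) (hρ : ContDiff ℝ ∞ ρ) (hρ0 : ∀ x, 0 ≤ ρ x) (hq : ContDiff ℝ ∞ q)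
    (hqρ : ∀ x, ρ x = 0 → (fun y => ‖q y‖ ^ 2) =O[𝓝 x] ρ) :
    ContDiff ℝ ∞ fun x => l (ρ x) • k (q x) := by
  refine contDiff_infty.2 fun n => ?_
  induction n generalizing G k l with
  | zero =>
    exact contDiff_zero.2 (continuous_iff_continuousAt.2 fun x =>
      (hk.hasFDerivAt_smul_comp hl hρ hρ0 hq hqρ x).continuousAt)
  | succ n ih =>
    have hdρ : ContDiff ℝ n (_root_.fderiv ℝ ρ) := hρ.fderiv_right (by exact_mod_cast le_top)
    have hdq : ContDiff ℝ n (_root_.fderiv ℝ q) := hq.fderiv_right (by exact_mod_cast le_top)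
    exact contDiff_succ_iff_hasFDerivAt.2 ⟨_,
      ((ih hk.fderiv hl).clm_comp hdq).add (hdρ.smulRight (ih hk hl.deriv)),
      hk.hasFDerivAt_smul_comp hl hρ hρ0 hq hqρ⟩

end FlatMultiplier

/-! ### The explicit lift -/

section LiftData

theorem IsSmoothFlat.fderiv_apply {h : R2 → ℝ} (hh : IsSmoothFlat h) (v : R2) :
    IsSmoothFlat fun c => _root_.fderiv ℝ h c v where
  contDiff := (hh.fderiv.contDiff).clm_apply contDiff_const
  vanishesToInfiniteOrder := hh.vanishesToInfiniteOrder.fderiv_apply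
    (hh.contDiff.contDiffAt.of_le (WithTop.coe_le_coe.2 le_top)) v

theorem IsFlat.exists_isSmoothFlat {h : R2 → ℝ} (hh : IsFlat h) :
    ∃ k, IsSmoothFlat k ∧ k =ᶠ[𝓝 0] h := by
  obtain ⟨k, hk, hkh⟩ := exists_contDiff_eventuallyEq hh.1
  refine ⟨k, ⟨hk, (vanishesToInfiniteOrder_iff hk).2 fun n => ?_⟩, hkh⟩
  rw [(hkh.iteratedFDeriv ℝ n).eq_of_nhds, hh.2 n]

theorem IsSmoothFlat.exists_eventuallyEq_mul {k g : R2 → ℝ} (hk : IsSmoothFlat k)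
    (hg : ∀ᶠ c in 𝓝 0, ContDiffAt ℝ ∞ g c) :
    ∃ m, IsSmoothFlat m ∧ m =ᶠ[𝓝 0] fun c => k c * g c := by
  obtain ⟨m, hm, hmk⟩ := exists_contDiff_eventuallyEq (f := fun c => k c * g c)
    (hg.mono fun c hc => hk.contDiff.contDiffAt.mul hc)
  exact ⟨m, ⟨hm, (hk.vanishesToInfiniteOrder.mul_of_continuousAt
    hg.self_of_nhds.continuousAt).congr hmk.symm⟩, hmk⟩

/-- Smooth flat functions with `dh + m₁ d(b + h) = m₂ da` near the origin, the data from which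
`modelLift` builds a lift of `(a, b) ↦ (a, b + h(a, b))`. -/
structure IsLiftData (h m₁ m₂ : R2 → ℝ) : Prop where
  isSmoothFlat : IsSmoothFlat h
  isSmoothFlat₁ : IsSmoothFlat m₁
  isSmoothFlat₂ : IsSmoothFlat m₂
  relation : ∀ᶠ c in 𝓝 (0 : R2), ∀ v : R2,
    fderiv ℝ h c v + m₁ c * (v 1 + fderiv ℝ h c v) = m₂ c * v 0

-- `m₁ = -h_b / (1 + h_b)` and `m₂ = h_a / (1 + h_b)`.
theorem IsFlat.exists_isLiftData {h₀ : R2 → ℝ} (hh : IsFlat h₀) :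
    ∃ h m₁ m₂, h =ᶠ[𝓝 0] h₀ ∧ IsLiftData h m₁ m₂ := by
  obtain ⟨h, hh, hh₀⟩ := hh.exists_isSmoothFlat
  have ha := hh.fderiv_apply ![1, 0]
  have hb := hh.fderiv_apply ![0, 1]
  have denom_ne_zero : ∀ᶠ c in 𝓝 (0 : R2), 1 + fderiv ℝ h c ![0, 1] ≠ 0 := by
    refine (continuous_const.add hb.contDiff.continuous).continuousAt.eventually_ne ?_
    rw [Pi.add_apply, hb.apply_zero, add_zero]
    exact one_ne_zero
  have inv_smooth : ∀ᶠ c in 𝓝 (0 : R2), ContDiffAt ℝ ∞ (fun c => (1 + fderiv ℝ h c ![0, 1])⁻¹) c :=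
    denom_ne_zero.mono fun c hc => (contDiffAt_const.add hb.contDiff.contDiffAt).inv hc
  obtain ⟨m₁, hm₁, hm₁_eq⟩ := hb.exists_eventuallyEq_mul (inv_smooth.mono fun c hc => hc.neg)
  obtain ⟨m₂, hm₂, hm₂_eq⟩ := ha.exists_eventuallyEq_mul inv_smooth
  refine ⟨h, m₁, m₂, hh₀, hh, hm₁, hm₂, ?_⟩
  filter_upwards [hm₁_eq, hm₂_eq, denom_ne_zero] with c h₁ h₂ hc v
  rw [h₁, h₂, clm_apply_eq_smul_add_smul (fderiv ℝ h c) v, smul_eq_mul, smul_eq_mul]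
  field_simp
  ring

end LiftData

section ModelLift

/-- `|z|² = x₁² + x₂²`, which vanishes exactly on the stable plane `z = 0`. -/
noncomputable def zNormSq (x : R4) : ℝ := Complex.normSq (zCoord x)

theorem contDiff_zNormSq : ContDiff ℝ ∞ zNormSq := contDiff_normSq_comp zCoord

theorem isBigO_norm_q_sq_zNormSq (x : R4) : (fun y => ‖q y‖ ^ 2) =O[𝓝 x] zNormSq := by
  have norm_sq_le (c : R2) : ‖c‖ ^ 2 ≤ c 0 ^ 2 + c 1 ^ 2 := by
    refine (Real.le_sqrt (norm_nonneg c) (by positivity)).1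
      ((pi_norm_le_iff_of_nonneg (Real.sqrt_nonneg _)).2 fun i => Real.abs_le_sqrt ?_)
    fin_cases i
    · exact le_add_of_nonneg_right (sq_nonneg _)
    · exact le_add_of_nonneg_left (sq_nonneg _)
  have bound : (fun y => ‖q y‖ ^ 2) =O[𝓝 x] fun y => zNormSq y * Complex.normSq (wCoord y) := by
    refine Asymptotics.isBigO_of_le _ fun y => ?_
    rw [zNormSq, normSq_zCoord_mul_normSq_wCoord, Real.norm_of_nonneg (by positivity)]
    exact (norm_sq_le (q y)).trans (le_abs_self _)
  have one := (contDiff_normSq_comp wCoord).continuous.continuousAt (x := x) |>.isBigO_one ℝ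
  simpa only [mul_one] using bound.trans ((Asymptotics.isBigO_refl zNormSq _).mul one)

theorem IsSmoothFlat.contDiff_mul_comp_q {k : R2 → ℝ} (hk : IsSmoothFlat k) {l : ℝ → ℝ}
    (hl : HasModerateGrowth l) : ContDiff ℝ ∞ fun x => l (zNormSq x) * k (q x) :=
  hk.contDiff_smul_comp hl contDiff_zNormSq (fun _ => Complex.normSq_nonneg _) contDiff_q
    fun x _ => isBigO_norm_q_sq_zNormSq x

variable {h m₁ m₂ : R2 → ℝ}

/-- The map `(z, w) ↦ (z, w + h(q) z / |z|²)`, a lift of `(a, b) ↦ (a, b + h(a, b))` which is not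
symplectic in general. On `z = 0` the quotient is `0` by the convention on division. -/
noncomputable def shear (h : R2 → ℝ) (x : R4) : R4 :=
  ofComplex (zCoord x) (wCoord x + ((zNormSq x)⁻¹ * h (q x) : ℝ) * zCoord x)

/-- The complex time `(m₁(q) - i m₂(q)) log |z|² / 2` for which the joint flow corrects `shear` to a
symplectic map. -/
noncomputable def flowTime (m₁ m₂ : R2 → ℝ) (x : R4) : ℂ :=
  ⟨Real.log (zNormSq x) * m₁ (q x) / 2, -(Real.log (zNormSq x) * m₂ (q x)) / 2⟩

/-- The symplectic lift of `(a, b) ↦ (a, b + h(a, b))`, see `IsLiftData.isSymplectic_modelLift`. -/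
noncomputable def modelLift (h m₁ m₂ : R2 → ℝ) (x : R4) : R4 :=
  flow (flowTime m₁ m₂ x) (shear h x)

theorem IsSmoothFlat.contDiff_shear (hh : IsSmoothFlat h) : ContDiff ℝ ∞ (shear h) :=
  contDiff_ofComplex zCoord.contDiff (wCoord.contDiff.add
    ((Complex.ofRealCLM.contDiff.comp (hh.contDiff_mul_comp_q hasModerateGrowth_inv)).mul
      zCoord.contDiff))

theorem contDiff_flowTime (h₁ : IsSmoothFlat m₁) (h₂ : IsSmoothFlat m₂) :
    ContDiff ℝ ∞ (flowTime m₁ m₂) :=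
  Complex.equivRealProdCLM.symm.contDiff.comp
    (((h₁.contDiff_mul_comp_q hasModerateGrowth_log).div_const 2).prodMk
      ((h₂.contDiff_mul_comp_q hasModerateGrowth_log).neg.div_const 2))

theorem contDiff_flow {E : Type*} [NormedAddCommGroup E] [NormedSpace ℝ E] {ζ : E → ℂ} {Y : E → R4}
    (hζ : ContDiff ℝ ∞ ζ) (hY : ContDiff ℝ ∞ Y) : ContDiff ℝ ∞ fun x => flow (ζ x) (Y x) :=
  contDiff_ofComplex (hζ.cexp.mul (zCoord.contDiff.comp hY))
    ((Complex.conjCLE.contDiff.comp hζ).neg.cexp.mul (wCoord.contDiff.comp hY))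

theorem IsLiftData.contDiff_modelLift (H : IsLiftData h m₁ m₂) :
    ContDiff ℝ ∞ (modelLift h m₁ m₂) :=
  contDiff_flow (contDiff_flowTime H.isSmoothFlat₁ H.isSmoothFlat₂) H.isSmoothFlat.contDiff_shear

theorem modelLift_zero : modelLift h m₁ m₂ 0 = 0 := by
  apply eq_of_zCoord_eq_of_wCoord_eq <;> simp [modelLift, shear]

theorem q_shear (hh : h 0 = 0) (x : R4) : q (shear h x) = ![q x 0, q x 1 + h (q x)] := by
  have cancel : (zNormSq x)⁻¹ * h (q x) * zNormSq x = h (q x) := by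
    rcases eq_or_ne (zNormSq x) 0 with hx | hx
    · rw [eq_zero_of_isBigO_norm_sq (isBigO_norm_q_sq_zNormSq x) hx, hh, mul_zero, zero_mul]
    · field_simp
  rw [q_eq_iff, shear, zCoord_ofComplex, wCoord_ofComplex, mul_add, ← toComplex_q, mul_left_comm,
    ← Complex.normSq_eq_conj_mul_self, ← zNormSq, ← Complex.ofReal_mul, cancel]
  apply Complex.ext <;> simp [toComplex_apply]

theorem q_modelLift (hh : h 0 = 0) (x : R4) :
    q (modelLift h m₁ m₂ x) = ![q x 0, q x 1 + h (q x)] := by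
  rw [modelLift, q_flow, q_shear hh]

end ModelLift

section SymplecticCorrection

variable {E : Type*} [NormedAddCommGroup E] [NormedSpace ℝ E] {x : E}

theorem hasFDerivAt_ofComplex {z w : E → ℂ} {z' w' : E →L[ℝ] ℂ} (hz : HasFDerivAt z z' x)
    (hw : HasFDerivAt w w' x) :
    ∃ F' : E →L[ℝ] R4, HasFDerivAt (fun x => ofComplex (z x) (w x)) F' x ∧
      ∀ u, F' u = ofComplex (z' u) (w' u) := by
  refine ⟨ContinuousLinearMap.pi ![Complex.reCLM ∘L z', Complex.reCLM ∘L w', Complex.imCLM ∘L z',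
    Complex.imCLM ∘L w'], hasFDerivAt_pi.2 fun i => ?_, fun u => ?_⟩
  · fin_cases i
    · exact Complex.reCLM.hasFDerivAt.comp x hz
    · exact Complex.reCLM.hasFDerivAt.comp x hw
    · exact Complex.imCLM.hasFDerivAt.comp x hz
    · exact Complex.imCLM.hasFDerivAt.comp x hw
  · ext i
    fin_cases i <;> rfl

theorem omegaCan_eq_re (u v : R4) : omegaCan u v =
    (starRingEnd ℂ (zCoord u) * wCoord v - starRingEnd ℂ (zCoord v) * wCoord u).re := by
  simp only [omegaCan, zCoord_apply, wCoord_apply, Complex.sub_re, Complex.mul_re, Complex.conj_re,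
    Complex.conj_im]
  ring

theorem omegaCan_flow (ζ : ℂ) (u v : R4) : omegaCan (flow ζ u) (flow ζ v) = omegaCan u v := by
  have cancel : starRingEnd ℂ (Complex.exp ζ) * Complex.exp (-starRingEnd ℂ ζ) = 1 := by
    rw [← Complex.exp_conj, ← Complex.exp_add, add_neg_cancel, Complex.exp_zero]
  simp only [omegaCan_eq_re, zCoord_flow, wCoord_flow, map_mul, mul_mul_mul_comm, cancel, one_mul]

theorem omegaCan_add_hamField (ζ ζ' : ℂ) (x u v : R4) :
    omegaCan (u + hamField ζ x) (v + hamField ζ' x) =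
      omegaCan u v + pairing ζ (fderiv ℝ q x v) - pairing ζ' (fderiv ℝ q x u) := by
  rw [← omegaCan_hamField, ← omegaCan_hamField]
  simp only [omegaCan_eq_re, hamField, map_add, zCoord_ofComplex, wCoord_ofComplex, map_mul,
    Complex.sub_re, Complex.mul_re, Complex.mul_im, Complex.add_re, Complex.add_im, Complex.neg_re,
    Complex.neg_im, Complex.conj_re, Complex.conj_im]
  ring

theorem omegaCan_fderiv_flow {ζ : E → ℂ} {Y : E → R4} {ζ' : E →L[ℝ] ℂ} {Y' : E →L[ℝ] R4}
    (hζ : HasFDerivAt ζ ζ' x) (hY : HasFDerivAt Y Y' x) (u v : E) :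
    omegaCan (fderiv ℝ (fun x => flow (ζ x) (Y x)) x u) (fderiv ℝ (fun x => flow (ζ x) (Y x)) x v) =
      omegaCan (Y' u) (Y' v) + pairing (ζ' u) (fderiv ℝ q (Y x) (Y' v)) -
        pairing (ζ' v) (fderiv ℝ q (Y x) (Y' u)) := by
  have hconj := (Complex.conjCLE.hasFDerivAt.comp x hζ).neg
  obtain ⟨F', hF, hF'⟩ := hasFDerivAt_ofComplex (hζ.cexp.mul (zCoord.hasFDerivAt.comp x hY))
    (hconj.cexp.mul (wCoord.hasFDerivAt.comp x hY))
  have fderiv_flow (u : E) : fderiv ℝ (fun x => flow (ζ x) (Y x)) x u =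
      flow (ζ x) (Y' u + hamField (ζ' u) (Y x)) := by
    refine (congrArg (· u) hF.fderiv).trans ((hF' u).trans ?_)
    apply eq_of_zCoord_eq_of_wCoord_eq
    · simp only [Function.comp_apply, add_apply, smul_apply, ContinuousLinearMap.comp_apply,
        smul_eq_mul, zCoord_ofComplex, hamField, zCoord_flow, map_add]
      ring
    · simp only [Function.comp_apply, add_apply, smul_apply, ContinuousLinearMap.comp_apply,
        smul_eq_mul, ContinuousAlgEquiv.coe_coeCLE, Pi.neg_apply, Complex.conjCAE_apply, smul_neg,
        neg_apply, ContinuousLinearEquiv.coe_coe, ContinuousAlgEquiv.coeCLE_apply, wCoord_ofComplex,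
        hamField, neg_mul, wCoord_flow, map_add]
      ring
  rw [fderiv_flow, fderiv_flow, omegaCan_flow, omegaCan_add_hamField]

end SymplecticCorrection

section SymplecticModelLift

variable {h m₁ m₂ : R2 → ℝ} {x : R4}

theorem fderiv_zNormSq_apply (x u : R4) :
    fderiv ℝ zNormSq x u = 2 * (starRingEnd ℂ (zCoord x) * zCoord u).re := by
  have hcoord (i : Fin 4) := hasFDerivAt_apply (𝕜 := ℝ) i x
  have hd : HasFDerivAt zNormSq _ x :=
    ((hcoord 0).mul (hcoord 0)).add ((hcoord 2).mul (hcoord 2))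
  rw [hd.fderiv]
  simp only [zCoord_apply, add_apply, smul_apply, ContinuousLinearMap.proj_apply, smul_eq_mul,
    Complex.mul_re, Complex.conj_re, Complex.conj_im]
  ring

theorem omegaCan_fderiv_add_mul_zCoord {H : R4 → ℝ} {H' : R4 →L[ℝ] ℝ} (hH : HasFDerivAt H H' x) :
    ∃ Y' : R4 →L[ℝ] R4,
      HasFDerivAt (fun x => ofComplex (zCoord x) (wCoord x + H x * zCoord x)) Y' x ∧
        ∀ u v, omegaCan (Y' u) (Y' v) = omegaCan u v +
          (fderiv ℝ zNormSq x u * H' v - fderiv ℝ zNormSq x v * H' u) / 2 := by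
  have hHz := (Complex.ofRealCLM.hasFDerivAt.comp x hH).mul zCoord.hasFDerivAt
  obtain ⟨Y', hY, hY'⟩ := hasFDerivAt_ofComplex zCoord.hasFDerivAt (wCoord.hasFDerivAt.add hHz)
  refine ⟨Y', hY, fun u v => ?_⟩
  rw [hY', hY']
  simp only [Function.comp_apply, Complex.ofRealCLM_apply, add_apply, smul_apply, smul_eq_mul,
    ContinuousLinearMap.comp_apply, omegaCan_eq_re, fderiv_zNormSq_apply, zCoord_ofComplex,
    wCoord_ofComplex, Complex.sub_re, Complex.mul_re, Complex.conj_re, Complex.add_re,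
    Complex.ofReal_re, Complex.ofReal_im, Complex.conj_im, Complex.add_im, Complex.mul_im]
  ring

theorem omegaCan_fderiv_shear (hh : DifferentiableAt ℝ h (q x)) (hx : zNormSq x ≠ 0) :
    ∃ Y' : R4 →L[ℝ] R4, HasFDerivAt (shear h) Y' x ∧ ∀ u v,
      omegaCan (Y' u) (Y' v) = omegaCan u v + (zNormSq x)⁻¹ *
        (fderiv ℝ zNormSq x u * fderiv ℝ h (q x) (fderiv ℝ q x v) -
          fderiv ℝ zNormSq x v * fderiv ℝ h (q x) (fderiv ℝ q x u)) / 2 := by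
  have hρ := (contDiff_zNormSq.differentiable (by simp) x).hasFDerivAt
  have hq := (contDiff_q.differentiable (by simp) x).hasFDerivAt
  obtain ⟨Y', hY, hY'⟩ := omegaCan_fderiv_add_mul_zCoord
    (((hasDerivAt_inv hx).comp_hasFDerivAt x hρ).mul (hh.hasFDerivAt.comp x hq))
  refine ⟨Y', hY, fun u v => ?_⟩
  rw [hY']
  simp only [Function.comp_apply, neg_smul, smul_neg, add_apply, smul_apply,
    ContinuousLinearMap.comp_apply, smul_eq_mul, neg_apply]
  ring

theorem fderiv_q_fderiv_shear (hh : DifferentiableAt ℝ h (q x)) (h0 : h 0 = 0) {Y' : R4 →L[ℝ] R4}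
    (hY : HasFDerivAt (shear h) Y' x) (v : R4) :
    fderiv ℝ q (shear h x) (Y' v) = ![fderiv ℝ q x v 0,
      fderiv ℝ q x v 1 + fderiv ℝ h (q x) (fderiv ℝ q x v)] := by
  have hq (x : R4) := (contDiff_q.differentiable (by simp) x).hasFDerivAt
  have hqi := hasFDerivAt_pi'.1 (hq x)
  have hcomp := hasFDerivAt_pi'.1 ((hq (shear h x)).comp x hY)
  have q_comp_shear : q ∘ shear h = fun x => ![q x 0, q x 1 + h (q x)] := funext (q_shear h0)
  rw [q_comp_shear] at hcomp
  ext i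
  fin_cases i
  · exact congrArg (· v) ((hcomp 0).unique (hqi 0))
  · exact congrArg (· v) ((hcomp 1).unique ((hqi 1).add (hh.hasFDerivAt.comp x (hq x))))

theorem fderiv_flowTime_apply (h₁ : DifferentiableAt ℝ m₁ (q x)) (h₂ : DifferentiableAt ℝ m₂ (q x))
    (hx : zNormSq x ≠ 0) :
    ∃ ζ' : R4 →L[ℝ] ℂ, HasFDerivAt (flowTime m₁ m₂) ζ' x ∧ ∀ u v,
      pairing (ζ' u) v =
        (zNormSq x)⁻¹ * fderiv ℝ zNormSq x u * (m₁ (q x) * v 1 - m₂ (q x) * v 0) / 2 +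
        Real.log (zNormSq x) * (fderiv ℝ m₁ (q x) (fderiv ℝ q x u) * v 1 -
          fderiv ℝ m₂ (q x) (fderiv ℝ q x u) * v 0) / 2 := by
  have hlog := (contDiff_zNormSq.differentiable (by simp) x).hasFDerivAt.log hx
  have hq := (contDiff_q.differentiable (by simp) x).hasFDerivAt
  have re' := (hlog.mul (h₁.hasFDerivAt.comp x hq)).mul_const (2⁻¹ : ℝ)
  have im' := (hlog.mul (h₂.hasFDerivAt.comp x hq)).neg.mul_const (2⁻¹ : ℝ)
  refine ⟨_, Complex.equivRealProdCLM.symm.hasFDerivAt.comp x (re'.prodMk im'), fun u v => ?_⟩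
  simp only [pairing, Function.comp_apply, smul_add, smul_neg, ContinuousLinearMap.comp_apply,
    ContinuousLinearMap.prod_apply, add_apply, smul_apply, smul_eq_mul, neg_apply,
    ContinuousLinearEquiv.coe_coe, Complex.equivRealProdCLM_symm_apply_im,
    Complex.equivRealProdCLM_symm_apply_re]
  ring

-- By the relation `m₁ d(b + h) - m₂ da = -dh` is closed.
theorem IsLiftData.fderiv_relation_symmetric (H : IsLiftData h m₁ m₂) :
    ∀ᶠ c in 𝓝 0, ∀ u v : R2,
      fderiv ℝ m₁ c u * (v 1 + fderiv ℝ h c v) - fderiv ℝ m₂ c u * v 0 =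
        fderiv ℝ m₁ c v * (u 1 + fderiv ℝ h c u) - fderiv ℝ m₂ c v * u 0 := by
  filter_upwards [H.relation.eventually_nhds] with c hc u v
  have hh := H.isSmoothFlat.contDiff
  have h₁ := (H.isSmoothFlat₁.contDiff.differentiable (by simp) c).hasFDerivAt
  have h₂ := (H.isSmoothFlat₂.contDiff.differentiable (by simp) c).hasFDerivAt
  have hdd := ((hh.fderiv_right (m := ∞) (by simp)).differentiable (by simp) c).hasFDerivAt
  have hd (v : R2) := hdd.clm_apply (hasFDerivAt_const v c)
  have second_symm := second_derivative_symmetric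
    (fun y => (hh.differentiable (by simp) y).hasFDerivAt) hdd u v
  have differentiated (u v : R2) : fderiv ℝ (fderiv ℝ h) c u v +
      (fderiv ℝ m₁ c u * (v 1 + fderiv ℝ h c v) + m₁ c * fderiv ℝ (fderiv ℝ h) c u v) =
        fderiv ℝ m₂ c u * v 0 := by
    have := congrArg (· u) (((hd v).add (h₁.mul ((hd v).const_add (v 1)))).unique
      ((h₂.mul_const (v 0)).congr_of_eventuallyEq (hc.mono fun c hc => hc v)))
    simp only [ContinuousLinearMap.comp_zero, zero_add, add_apply, ContinuousLinearMap.flip_apply,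
      smul_apply, smul_eq_mul] at this
    linarith
  linear_combination differentiated u v - differentiated v u - (1 + m₁ c) * second_symm

theorem IsLiftData.omegaCan_fderiv_modelLift_of_ne_zero (H : IsLiftData h m₁ m₂)
    (hx : zNormSq x ≠ 0)
    (relation : ∀ v, fderiv ℝ h (q x) v + m₁ (q x) * (v 1 + fderiv ℝ h (q x) v) = m₂ (q x) * v 0)
    (symmetric : ∀ u v,
      fderiv ℝ m₁ (q x) u * (v 1 + fderiv ℝ h (q x) v) - fderiv ℝ m₂ (q x) u * v 0 =
        fderiv ℝ m₁ (q x) v * (u 1 + fderiv ℝ h (q x) u) - fderiv ℝ m₂ (q x) v * u 0) (u v : R4) :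
    omegaCan (fderiv ℝ (modelLift h m₁ m₂) x u) (fderiv ℝ (modelLift h m₁ m₂) x v) =
      omegaCan u v := by
  have hh := H.isSmoothFlat.contDiff.differentiable (by simp) (q x)
  obtain ⟨Y', hY, omegaCan_shear⟩ := omegaCan_fderiv_shear hh hx
  obtain ⟨ζ', hζ, pairing_time⟩ := fderiv_flowTime_apply
    (H.isSmoothFlat₁.contDiff.differentiable (by simp) (q x))
    (H.isSmoothFlat₂.contDiff.differentiable (by simp) (q x)) hx
  refine (omegaCan_fderiv_flow hζ hY u v).trans ?_
  simp only [omegaCan_shear, pairing_time,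
    fderiv_q_fderiv_shear hh H.isSmoothFlat.apply_zero hY, Matrix.cons_val]
  set U := fderiv ℝ q x u
  set V := fderiv ℝ q x v
  linear_combination (zNormSq x)⁻¹ / 2 * (fderiv ℝ zNormSq x u * relation V -
    fderiv ℝ zNormSq x v * relation U) + Real.log (zNormSq x) / 2 * symmetric U V

theorem dense_zNormSq_ne_zero : Dense {x | zNormSq x ≠ 0} := by
  have zCoord_surjective : Function.Surjective zCoord := fun z => ⟨ofComplex z 0, rfl⟩
  simp only [zNormSq, ne_eq, map_eq_zero]
  exact (dense_compl_singleton 0).preimage (zCoord.isOpenMap zCoord_surjective)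

theorem IsLiftData.isSymplectic_modelLift (H : IsLiftData h m₁ m₂) : ∀ᶠ x in 𝓝 (0 : R4), ∀ u v,
    omegaCan (fderiv ℝ (modelLift h m₁ m₂) x u) (fderiv ℝ (modelLift h m₁ m₂) x v) =
      omegaCan u v := by
  filter_upwards [(q_tendsto.eventually
    (H.relation.and H.fderiv_relation_symmetric)).eventually_nhds] with x hx u v
  have fderiv_continuous (u : R4) : Continuous fun x => fderiv ℝ (modelLift h m₁ m₂) x u :=
    (H.contDiff_modelLift.continuous_fderiv (by simp)).clm_apply continuous_const
  have pairing_continuous : Continuous fun x => omegaCan (fderiv ℝ (modelLift h m₁ m₂) x u)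
      (fderiv ℝ (modelLift h m₁ m₂) x v) := by
    unfold omegaCan
    fun_prop
  obtain ⟨U, hU, hU_open, hxU⟩ := eventually_nhds_iff.1 hx
  refine closure_minimal (fun y hy => ?_) (isClosed_eq pairing_continuous continuous_const)
    (dense_zNormSq_ne_zero.open_subset_closure_inter hU_open hxU)
  exact H.omegaCan_fderiv_modelLift_of_ne_zero hy.2 (hU y hy.1).1 (hU y hy.1).2 u v

end SymplecticModelLift

/-! ### Every germ in `G` lifts -/

section InverseFunction

theorem exists_diffeoGerm_val_eq {E : Type*} [NormedAddCommGroup E] [NormedSpace ℝ E]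
    [CompleteSpace E] (f : PointedMap E) {e : E ≃L[ℝ] E}
    (he : fderiv ℝ f.toFun 0 = (e : E →L[ℝ] E)) : ∃ φ : DiffeoGerm E, φ.val = germ f := by
  have smooth := f.smooth.self_of_nhds
  have hd : HasFDerivAt f.toFun (e : E →L[ℝ] E) 0 :=
    he ▸ (smooth.differentiableAt (by simp)).hasFDerivAt
  let P := smooth.toOpenPartialHomeomorph f.toFun hd (by simp)
  have mem_source : 0 ∈ P.source := smooth.mem_toOpenPartialHomeomorph_source hd (by simp)
  have map_zero : P 0 = 0 := f.map_zero
  have mem_target : 0 ∈ P.target := map_zero ▸ P.map_source mem_source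
  have symm_zero : P.symm 0 = 0 := by simpa only [map_zero] using P.left_inv mem_source
  have symm_tendsto : Tendsto P.symm (𝓝 0) (𝓝 0) := by
    simpa only [symm_zero] using (P.symm.continuousAt mem_target).tendsto
  have fderiv_invertible : ∀ᶠ x in 𝓝 0, ∃ e : E ≃L[ℝ] E, (e : E →L[ℝ] E) = fderiv ℝ f.toFun x :=
    (smooth.continuousAt_fderiv (by simp)).eventually (he ▸ e.nhds)
  refine ⟨⟨germ f, germ ⟨P.symm, symm_zero, ?_⟩, germ_eq_iff.2 ?_, germ_eq_iff.2 ?_⟩, rfl⟩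
  · filter_upwards [P.open_target.mem_nhds mem_target, symm_tendsto.eventually fderiv_invertible,
      symm_tendsto.eventually f.smooth] with y hy ⟨e', he'⟩ hf
    refine P.contDiffAt_symm hy (f₀' := e') ?_ hf
    exact he' ▸ (hf.differentiableAt (by simp)).hasFDerivAt
  · exact P.eventually_right_inverse mem_target
  · exact P.eventually_left_inverse mem_source

theorem exists_diffeoGerm_of_omegaCan_fderiv_eq (f : PointedMap R4)
    (hf : ∀ᶠ x in 𝓝 0, ∀ u v,
      omegaCan (fderiv ℝ f.toFun x u) (fderiv ℝ f.toFun x v) = omegaCan u v) :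
    ∃ φ : DiffeoGerm R4, φ.val = germ f ∧ IsSymplectic φ.val := by
  have surjective := surjective_of_omegaCan_eq hf.self_of_nhds
  let e : R4 ≃L[ℝ] R4 := (LinearEquiv.ofBijective (fderiv ℝ f.toFun 0 : R4 →ₗ[ℝ] R4)
    ⟨LinearMap.injective_iff_surjective.2 surjective, surjective⟩).toContinuousLinearEquiv
  obtain ⟨φ, hφ⟩ := exists_diffeoGerm_val_eq f (e := e) rfl
  exact ⟨φ, hφ, hφ ▸ (isSymplectic_germ f).2 hf⟩

end InverseFunction

section LinearModels

theorem signMap_apply (ε : ℤˣ × ℤˣ) (c : R2) :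
    signMap ε c = ![((ε.1 : ℤ) : ℝ) * c 0, ((ε.2 : ℤ) : ℝ) * c 1] := rfl

theorem A_apply (ε : ℤˣ × ℤˣ) (x : R4) :
    A ε x = (if ε.1 = -1 then A10 else 1) ((if ε.2 = -1 then A01 else 1) x) := rfl

theorem forall_sign_pairs {p : ℤˣ × ℤˣ → Prop} (h₁ : p (1, 1)) (h₂ : p (-1, 1)) (h₃ : p (1, -1))
    (h₄ : p (-1, -1)) (ε : ℤˣ × ℤˣ) : p ε := by
  obtain ⟨a, b⟩ := ε
  rcases Int.units_eq_one_or a with rfl | rfl <;> rcases Int.units_eq_one_or b with rfl | rfl <;>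
    assumption

theorem A_one_one_apply (x : R4) : A (1, 1) x = x := by
  rw [A_apply, if_neg (by decide), if_neg (by decide)]
  rfl

theorem A_neg_one_one_apply (x : R4) : A (-1, 1) x = ![x 2, x 3, x 0, x 1] := by
  rw [A_apply, if_pos rfl, if_neg (by decide)]
  rfl

theorem A_one_neg_one_apply (x : R4) : A (1, -1) x = ![x 1, -x 0, x 3, -x 2] := by
  rw [A_apply, if_neg (by decide), if_pos rfl]
  rfl

theorem A_neg_one_neg_one_apply (x : R4) : A (-1, -1) x = ![x 3, -x 2, x 1, -x 0] := by
  rw [A_apply, if_pos rfl, if_pos rfl]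
  rfl

theorem omegaCan_A (ε : ℤˣ × ℤˣ) (u v : R4) : omegaCan (A ε u) (A ε v) = omegaCan u v := by
  revert ε
  apply forall_sign_pairs <;>
    simp only [A_one_one_apply, A_neg_one_one_apply, A_one_neg_one_apply, A_neg_one_neg_one_apply,
      omegaCan, Matrix.cons_val] <;> ring

theorem q_A (ε : ℤˣ × ℤˣ) (x : R4) : q (A ε x) = signMap ε (q x) := by
  revert ε
  apply forall_sign_pairs <;> rw [signMap_apply] <;>
    simp only [A_one_one_apply, A_neg_one_one_apply, A_one_neg_one_apply, A_neg_one_neg_one_apply,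
      q, Matrix.cons_val, Units.val_neg, Units.val_one, Int.cast_neg, Int.cast_one] <;> ring_nf

theorem A_mul_comm (ε ε' : ℤˣ × ℤˣ) : A ε * A ε' = A ε' * A ε := by
  refine ContinuousLinearEquiv.ext (funext fun x => ?_)
  change A ε (A ε' x) = A ε' (A ε x)
  revert ε ε'
  refine forall_sign_pairs ?_ ?_ ?_ ?_ <;> refine forall_sign_pairs ?_ ?_ ?_ ?_ <;>
    simp [A_one_one_apply, A_neg_one_one_apply, A_one_neg_one_apply, A_neg_one_neg_one_apply]

theorem A_mul_apply_eq_or_eq_neg (ε ε' : ℤˣ × ℤˣ) :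
    (∀ x, A (ε * ε') x = A ε (A ε' x)) ∨ (∀ x, A (ε * ε') x = -A ε (A ε' x)) := by
  revert ε ε'
  refine forall_sign_pairs ?_ ?_ ?_ ?_ <;> refine forall_sign_pairs ?_ ?_ ?_ ?_ <;>
    simp [A_one_one_apply, A_neg_one_one_apply, A_one_neg_one_apply, A_neg_one_neg_one_apply,
      funext_iff, Fin.forall_fin_succ]

theorem eq_of_forall_signMap_q_eq {ε ε' : ℤˣ × ℤˣ}
    (h : ∀ x, signMap ε (q x) = signMap ε' (q x)) : ε = ε' := by
  have q_value : q ![1, 1, 0, 1] = ![1, 1] := by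
    simp only [q, Matrix.cons_val]
    norm_num
  have h01 := h ![1, 1, 0, 1]
  rw [q_value, signMap_apply, signMap_apply] at h01
  have h0 : ((ε.1 : ℤ) : ℝ) = (ε'.1 : ℤ) := by simpa using congrFun h01 0
  have h1 : ((ε.2 : ℤ) : ℝ) = (ε'.2 : ℤ) := by simpa using congrFun h01 1
  exact Prod.ext (Units.ext (Int.cast_injective h0)) (Units.ext (Int.cast_injective h1))

theorem q_neg (x : R4) : q (-x) = q x := by
  simp only [q, Pi.neg_apply, neg_mul_neg]

theorem eq_of_A_eq_or_eq_neg {ε ε' : ℤˣ × ℤˣ}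
    (h : (∀ x, A ε x = A ε' x) ∨ (∀ x, A ε x = -A ε' x)) : ε = ε' := by
  refine eq_of_forall_signMap_q_eq fun x => ?_
  rcases h with h | h
  · rw [← q_A, ← q_A, h]
  · rw [← q_A, ← q_A, h, q_neg]

theorem isSymplectic_linearGerm_A (ε : ℤˣ × ℤˣ) : IsSymplectic (linearGerm (A ε)).val := by
  refine (isSymplectic_germ _).2 (Eventually.of_forall fun x u v => ?_)
  have fderiv_eq : fderiv ℝ (PointedMap.ofLinear (A ε : R4 →L[ℝ] R4)).toFun x = A ε :=
    (A ε : R4 →L[ℝ] R4).fderiv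
  rw [fderiv_eq]
  exact omegaCan_A ε u v

theorem intertwines_linearGerm_A (ε : ℤˣ × ℤˣ) :
    Intertwines (linearGerm (A ε)).val (linearGerm (signMap ε)).val :=
  (intertwines_germ _ _).2 (Eventually.of_forall (q_A ε))

end LinearModels

section BaseMap

theorem IsFlat.exists_symplectic_lift {h₀ : R2 → ℝ} (hh : IsFlat h₀) :
    ∃ (f : PointedMap R4) (φ : DiffeoGerm R4), φ.val = germ f ∧ IsSymplectic φ.val ∧
      ∀ᶠ x in 𝓝 0, q (f.toFun x) = ![q x 0, q x 1 + h₀ (q x)] := by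
  obtain ⟨h, m₁, m₂, hh₀, H⟩ := hh.exists_isLiftData
  let f : PointedMap R4 := ⟨modelLift h m₁ m₂, modelLift_zero,
    Eventually.of_forall fun _ => H.contDiff_modelLift.contDiffAt⟩
  obtain ⟨φ, hφ, hφs⟩ := exists_diffeoGerm_of_omegaCan_fderiv_eq f H.isSymplectic_modelLift
  refine ⟨f, φ, hφ, hφs, ?_⟩
  filter_upwards [q_tendsto.eventually hh₀] with x hx
  rw [← hx]
  exact q_modelLift H.isSmoothFlat.apply_zero x

theorem exists_lift_of_hasFlatForm {g : DiffeoGerm R2} (hg : HasFlatForm g.val) :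
    ∃ φ : DiffeoGerm R4, IsSymplectic φ.val ∧ Intertwines φ.val g.val := by
  obtain ⟨k, hk, ε, h, hh, hkh⟩ := hg
  obtain ⟨f, φ, hφ, hφs, hf⟩ := (hh.const_mul ((ε.2 : ℤ) : ℝ)).exists_symplectic_lift
  refine ⟨linearGerm (A ε) * φ, (isSymplectic_linearGerm_A ε).mul hφs, ?_⟩
  rw [Units.val_mul, hφ, ← hk]
  refine (intertwines_germ _ _).2 ?_
  filter_upwards [hf, q_tendsto.eventually hkh] with x hfx hkx
  have q_lift : q (A ε (f.toFun x)) = signMap ε (q (f.toFun x)) := q_A ε _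
  rw [hkx]
  refine q_lift.trans ?_
  rw [hfx, signMap_apply]
  simp only [Matrix.cons_val, Pi.smul_apply, smul_eq_mul, mul_add, ← mul_assoc,
    units_coe_mul_self_real, one_mul]

theorem Aut.exists_intertwines (φ : Aut) : ∃ g : G, Intertwines φ.val.val g.val.val := by
  obtain ⟨hφ, g, hg⟩ := φ.2
  exact ⟨⟨g, hasFlatForm_of_intertwines hφ hg⟩, hg⟩

/-- The homomorphism sending `φ` to the germ `g` with `q ∘ φ = g ∘ q`. -/
noncomputable def baseMap : Aut →* G :=
  MonoidHom.mk' (fun φ => (Aut.exists_intertwines φ).choose) fun φ ψ =>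
    Subtype.ext (Units.ext (intertwines_unique (Aut.exists_intertwines (φ * ψ)).choose_spec
      ((Aut.exists_intertwines φ).choose_spec.mul (Aut.exists_intertwines ψ).choose_spec)))

theorem intertwines_baseMap (φ : Aut) : Intertwines φ.val.val (baseMap φ).val.val :=
  (Aut.exists_intertwines φ).choose_spec

theorem intertwines_iff_eq_baseMap (φ : Aut) (g : DiffeoGerm R2) :
    Intertwines φ.val.val g.val ↔ g = (baseMap φ).val :=
  ⟨fun h => Units.ext (intertwines_unique h (intertwines_baseMap φ)),
    fun h => h ▸ intertwines_baseMap φ⟩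

theorem baseMap_surjective : Function.Surjective baseMap := by
  intro g
  obtain ⟨φ, hφ, hφg⟩ := exists_lift_of_hasFlatForm g.2
  exact ⟨⟨φ, hφ, g.val, hφg⟩, Subtype.ext ((intertwines_iff_eq_baseMap _ _).1 hφg).symm⟩

end BaseMap

end FocusFocus

theorem mainTheorem4 :
    -- a germ `g` occurs in a pair `(φ, g)` with `q ∘ φ = g ∘ q` if and only if `g ∈ G`
    (∀ g : FocusFocus.DiffeoGerm FocusFocus.R2,
      (∃ φ : FocusFocus.DiffeoGerm FocusFocus.R4,
        FocusFocus.IsSymplectic φ.val ∧ FocusFocus.Intertwines φ.val g.val) ↔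
      g ∈ FocusFocus.G) ∧
    -- `φ ↦ g` is a well-defined homomorphism `Aut → G`; it is onto, and `A_ε ↦ g_ε`
    (∃ Φ : FocusFocus.Aut →* FocusFocus.G,
      (∀ (φ : FocusFocus.Aut) (g : FocusFocus.DiffeoGerm FocusFocus.R2),
        FocusFocus.Intertwines φ.val.val g.val ↔ g = (Φ φ).val) ∧
      Function.Surjective Φ ∧
      ∀ ε : ℤˣ × ℤˣ, ∃ hA : FocusFocus.linearGerm (FocusFocus.A ε) ∈ FocusFocus.Aut,
        (Φ ⟨FocusFocus.linearGerm (FocusFocus.A ε), hA⟩).val =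
          FocusFocus.linearGerm (FocusFocus.signMap ε)) ∧
    -- the `A_ε` are linear symplectomorphisms of `ℝ⁴` with `q ∘ A_ε = g_ε ∘ q` everywhere
    (∀ ε : ℤˣ × ℤˣ,
      (∀ u v : FocusFocus.R4,
        FocusFocus.omegaCan (FocusFocus.A ε u) (FocusFocus.A ε v) = FocusFocus.omegaCan u v) ∧
      ∀ x : FocusFocus.R4,
        FocusFocus.q (FocusFocus.A ε x) = FocusFocus.signMap ε (FocusFocus.q x)) ∧
    -- the `A_ε` commute, and `ε ↦ A_ε` is an injective homomorphism modulo `± 1`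
    (∀ ε ε' : ℤˣ × ℤˣ,
      FocusFocus.A ε * FocusFocus.A ε' = FocusFocus.A ε' * FocusFocus.A ε ∧
      ((∀ x, FocusFocus.A (ε * ε') x = FocusFocus.A ε (FocusFocus.A ε' x)) ∨
        (∀ x, FocusFocus.A (ε * ε') x = -FocusFocus.A ε (FocusFocus.A ε' x))) ∧
      (((∀ x, FocusFocus.A ε x = FocusFocus.A ε' x) ∨
        (∀ x, FocusFocus.A ε x = -FocusFocus.A ε' x)) → ε = ε')) := by
  refine ⟨fun g => ⟨fun ⟨φ, hφ, hφg⟩ => FocusFocus.hasFlatForm_of_intertwines hφ hφg,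
    fun hg => FocusFocus.exists_lift_of_hasFlatForm hg⟩,
    ⟨FocusFocus.baseMap, FocusFocus.intertwines_iff_eq_baseMap, FocusFocus.baseMap_surjective,
      fun ε => ?_⟩,
    fun ε => ⟨FocusFocus.omegaCan_A ε, FocusFocus.q_A ε⟩,
    fun ε ε' => ⟨FocusFocus.A_mul_comm ε ε', FocusFocus.A_mul_apply_eq_or_eq_neg ε ε',
      FocusFocus.eq_of_A_eq_or_eq_neg⟩⟩
  exact ⟨⟨FocusFocus.isSymplectic_linearGerm_A ε, _, FocusFocus.intertwines_linearGerm_A ε⟩,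
    ((FocusFocus.intertwines_iff_eq_baseMap _ _).1
      (FocusFocus.intertwines_linearGerm_A ε)).symm⟩
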